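/- A pseudoline is the image of a line under a homeomorphism of the Euclidean plane $\mathbb{R}^2$. A simple pseudoline arrangement is a collection $L$ of at least three pseudolines in $\mathbb{R}^2$ such that any two of them intersect exactly once, where they cross each other, and no three of them meet at a point. The pseudoline arrangement graph induced by $L$ has as vertices the intersection points of pseudolines in $L$; two distinct vertices are adjacent if they lie on a common pseudoline $l\in L$ with no other vertex on the part of $l$ between them. Line arrangement graphs are defined in the same way with lines in place of pseudolines. The degree sequence of a finite graph is the non-increasing list of the degrees of its vertices, and $\langle a^{d}\rangle$ denotes the sequence $a,\dots,a$ of length $d$. **Theorem.** A finite non-increasing sequence $\pi$ of positive integers is the degree sequence of a pseudoline arrangement graph if and only if, for some integer $n\ge 3$, both of the following hold: 1. $\pi=\langle 4^{d_4},3^{d_3},2^{d_2}\rangle$ with $3\le d_2\le n$, $d_3=2(n-d_2)$ and $d_4=\frac{n(n-5)}{2}+d_2$; 2. if $d_2=n$, then $n$ is odd. Moreover, the same characterization holds for line arrangement graphs: $\pi$ is the degree sequence of a line arrangement graph if and only if conditions 1 and 2 hold for some integer $n\ge 3$. -/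

import Mathlib

namespace PlaneArrangement

/-- The Euclidean plane. -/
abbrev Plane : Type := EuclideanSpace ℝ (Fin 2)

/-- A set of points of the plane is a (straight) line. -/
def IsLine (l : Set Plane) : Prop :=
  ∃ a b : Plane, a ≠ b ∧ l = (affineSpan ℝ {a, b} : Set Plane)

/-- A pseudoline is the image of a line under a homeomorphism of the plane. -/
def IsPseudoline (l : Set Plane) : Prop :=
  ∃ m : Set Plane, IsLine m ∧ ∃ f : Plane ≃ₜ Plane, l = f '' m

/-- `l` separates the points `x` and `y`: they lie off `l`, in different connected components
of the complement of `l` (the two pseudohalfplanes, when `l` is a pseudoline). -/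
def Separates (l : Set Plane) (x y : Plane) : Prop :=
  x ∉ l ∧ y ∉ l ∧ y ∉ connectedComponentIn lᶜ x

/-- `l'` has points on different sides of `l`. When `l` and `l'` are pseudolines with exactly
one common point, each of the two branches of `l'` at this point lies on one side of `l`,
so this says that `l'` passes at this point from one side of `l` to the other. -/
def ChangesSide (l l' : Set Plane) : Prop :=
  ∃ x ∈ l', ∃ y ∈ l', Separates l x y

/-- `l` and `l'` intersect exactly once, and they cross each other there. -/
def CrossOnce (l l' : Set Plane) : Prop :=
  (∃ p, l ∩ l' = {p}) ∧ ChangesSide l l' ∧ ChangesSide l' l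

/-- `L` is a simple arrangement of curves of the kind `P` (lines or pseudolines): at least three
curves, each two of which intersect exactly once and cross there, no three through a point. -/
structure IsSimpleArrangement (P : Set Plane → Prop) (L : Set (Set Plane)) : Prop where
  three_le : 3 ≤ L.encard
  kind : ∀ l ∈ L, P l
  cross : ∀ l ∈ L, ∀ l' ∈ L, l ≠ l' → CrossOnce l l'
  simple : ∀ l ∈ L, ∀ l' ∈ L, ∀ l'' ∈ L, l ≠ l' → l ≠ l'' → l' ≠ l'' → l ∩ l' ∩ l'' = ∅

/-- The vertices of an arrangement: the intersection points of two of its members. -/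
def vertices (L : Set (Set Plane)) : Set Plane :=
  {p | ∃ l ∈ L, ∃ l' ∈ L, l ≠ l' ∧ p ∈ l ∧ p ∈ l'}

/-- For points `u`, `v` of a line or pseudoline `l`: the point `w` of `l` lies strictly between
`u` and `v` on `l`, that is, removing `w` from `l` disconnects `u` from `v` within `l`. -/
def LiesBetween (l : Set Plane) (u w v : Plane) : Prop :=
  w ∈ l ∧ w ≠ u ∧ w ≠ v ∧ v ∉ connectedComponentIn (l \ {w}) u

theorem LiesBetween.symm {l : Set Plane} {u w v : Plane}
    (h : LiesBetween l u w v) : LiesBetween l v w u := by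
  obtain ⟨hw, hwu, hwv, hc⟩ := h
  refine ⟨hw, hwv, hwu, fun hmem => hc ?_⟩
  rw [← connectedComponentIn_eq hmem]
  refine mem_connectedComponentIn (connectedComponentIn_nonempty_iff.mp ⟨u, hmem⟩)

/-- The graph induced by an arrangement: two vertices are adjacent when they appear on a common
member of the arrangement with no other vertex between them on it. -/
def arrangementGraph (L : Set (Set Plane)) : SimpleGraph (vertices L) where
  Adj u v := u ≠ v ∧ ∃ l ∈ L, (u : Plane) ∈ l ∧ (v : Plane) ∈ l ∧
    ∀ w ∈ vertices L, ¬ LiesBetween l u w v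
  symm := ⟨by
    rintro u v ⟨huv, l, hl, hu, hv, h⟩
    exact ⟨huv.symm, l, hl, hv, hu, fun w hw hb => h w hw hb.symm⟩⟩
  loopless := ⟨fun _ h => h.1 rfl⟩

/-- `π` is the degree sequence of the graph `G`: the non-increasing list of the degrees of all
its vertices (in particular `G` is finite). -/
def IsDegreeSequence {V : Type*} (G : SimpleGraph V) (π : List ℕ) : Prop :=
  π.Pairwise (· ≥ ·) ∧
    ∃ e : Fin π.length ≃ V, ∀ i, (G.neighborSet (e i)).encard = (π.get i : ℕ∞)

/-- `π` is the degree sequence of the graph of some simple arrangement of curves of kind `P`. -/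
def IsArrangementDegreeSequence (P : Set Plane → Prop) (π : List ℕ) : Prop :=
  ∃ L : Set (Set Plane), IsSimpleArrangement P L ∧ IsDegreeSequence (arrangementGraph L) π

/-- `π = ⟨4^{d₄}, 3^{d₃}, 2^{d₂}⟩` with `3 ≤ d₂ ≤ n`, `d₃ = 2 (n - d₂)` and
`d₄ = n (n - 5) / 2 + d₂` for some integer `n ≥ 3`; and if `d₂ = n` then `n` is odd. -/
def DegreeCondition (π : List ℕ) : Prop :=
  ∃ n d₂ d₃ d₄ : ℕ, 3 ≤ n ∧
    (π = List.replicate d₄ 4 ++ List.replicate d₃ 3 ++ List.replicate d₂ 2 ∧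
      3 ≤ d₂ ∧ d₂ ≤ n ∧
      (d₃ : ℝ) = 2 * ((n : ℝ) - d₂) ∧
      (d₄ : ℝ) = (n : ℝ) * ((n : ℝ) - 5) / 2 + d₂) ∧
    (d₂ = n → Odd n)

end PlaneArrangement

/-!
The vertices of an arrangement of `n` curves are the crossings of its pairs of curves. A
vertex has one or two neighbours on each of its two curves, one exactly if it is an end of the
sequence of vertices along that curve. So all degrees are `2`, `3` or `4`, and as every curve has
two ends, `d₃ + 2 d₂ = 2 n` (`degreeCount_three_add`); with `d₂ + d₃ + d₄ = n (n - 1) / 2` this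
expresses `d₃` and `d₄` through `n` and `d₂`. What is left is to find the possible values of `d₂`,
the number of vertices that are ends of both of their curves.

*Necessity.* From the topology only the following is kept (`IsSidedCrossing`): the order `t i` of
the crossings along each curve `i`, and the side of each curve `k` on which the two branches of
`i` lie; computing the side of `k` on which the crossing of `i` and `j` lies along `i` and along
`j` gives the same result. Fix a curve `l` and a side `H` of it. Each other curve has a ray in
`H`, and these rays are linearly ordered "at infinity" (`RaySystem.trans`). If two rays cross in
`H`, then some crossing in `H` is the last one on both of its rays
(`RaySystem.exists_mutual_last`): let `f i` be the ray that crosses `i` last, let `b` be the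
greatest ray with `b < f b`, and let `a` be the least ray above `b` that has a crossing; then `f a
= b` and `f b = a`. Hence each side of `l` that contains a vertex contains a vertex of degree two.
This yields three of them: if some curve `a` through a vertex of degree two has vertices on both
sides, there is one more on each side; otherwise both ends of `a` have degree two, and there is
one off `a` (`IsSidedCrossing.exists_three_isExtreme_pairs`).

If `d₂ = n`, then `d₃ = 0`, so an end of one curve is an end of the other one too. Fix a curve `l`
and let `H` be the side of `l` that contains the crossing of the two curves through the ends of
`l`. Then every ray in `H` has a crossing in `H`, and `f` is an involution without fixed points on
the `n - 1` rays, so `n` is odd (`IsSidedCrossing.odd_card`).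

*Sufficiency.* For nonvertical lines the crossings are ordered by abscissa. Tangents `y = -v² x +
2 v` of the hyperbola `x y = 1` cross at abscissa `2 / (v + w)`, and the parameters `±1, ∓2, …,
-(d - 1), d, d + 1, …, n` give exactly `d` vertices of degree two when `3 ≤ d < n`
(`existsLines_of_lt`). For odd `n` the sides of a regular `n`-gon give `d₂ = n`
(`existsLines_self`).
-/

open Set Topology

namespace PlaneArrangement

/-! ### Lines and pseudolines: parametrizations and sides -/

theorem exists_isEmbedding_and_side_of_isLine {l : Set Plane} (hl : IsLine l) :
    (∃ φ : ℝ → Plane, IsEmbedding φ ∧ range φ = l) ∧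
    ∃ F : Plane →ᵃ[ℝ] ℝ, ∀ x, F x = 0 ↔ x ∈ l := by
  obtain ⟨a, b, hab, rfl⟩ := hl
  have hd : (b 0 - a 0) ^ 2 + (b 1 - a 1) ^ 2 ≠ 0 := by
    intro h
    refine hab (PiLp.ext fun i => ?_)
    fin_cases i <;> simp only [Fin.zero_eta, Fin.mk_one] <;>
      nlinarith [sq_nonneg (b 0 - a 0), sq_nonneg (b 1 - a 1)]
  -- orthogonal projection onto the line, in the coordinate of `AffineMap.lineMap a b`
  let c : Plane → ℝ := fun x =>
    ((x 0 - a 0) * (b 0 - a 0) + (x 1 - a 1) * (b 1 - a 1)) /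
      ((b 0 - a 0) ^ 2 + (b 1 - a 1) ^ 2)
  have hcoord : ∀ (s : ℝ) (i : Fin 2),
      (AffineMap.lineMap a b s : Plane) i = a i + s * (b i - a i) := by
    intro s i
    simp [AffineMap.lineMap_apply]
    ring
  refine ⟨⟨fun s => AffineMap.lineMap a b s, ?_, ?_⟩, ?_⟩
  · refine Function.LeftInverse.isEmbedding (f := c) (fun s => ?_) ?_ ?_
    · simp only [c, hcoord]
      rw [div_eq_iff hd]
      ring
    · fun_prop
    · exact AffineMap.lineMap_continuous
  · ext x
    simp only [mem_range, SetLike.mem_coe, mem_affineSpan_pair_iff_exists_lineMap_eq]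
  · let G : Plane →ₗ[ℝ] ℝ := (b 1 - a 1) • (EuclideanSpace.proj 0 : Plane →L[ℝ] ℝ).toLinearMap
      - (b 0 - a 0) • (EuclideanSpace.proj 1 : Plane →L[ℝ] ℝ).toLinearMap
    have hG : ∀ x, (G.toAffineMap - AffineMap.const ℝ Plane (G a)) x
        = (b 1 - a 1) * (x 0 - a 0) - (b 0 - a 0) * (x 1 - a 1) := by
      intro x
      simp [G]
      ring
    refine ⟨G.toAffineMap - AffineMap.const ℝ Plane (G a), fun x => ?_⟩
    rw [hG, SetLike.mem_coe, mem_affineSpan_pair_iff_exists_lineMap_eq]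
    constructor
    · intro h
      refine ⟨c x, PiLp.ext fun i => ?_⟩
      rw [hcoord]
      have : c x * ((b 0 - a 0) ^ 2 + (b 1 - a 1) ^ 2)
        = (x 0 - a 0) * (b 0 - a 0) + (x 1 - a 1) * (b 1 - a 1) := div_mul_cancel₀ _ hd
      refine mul_right_cancel₀ hd ?_
      fin_cases i <;> simp only [Fin.zero_eta, Fin.mk_one]
      · linear_combination (b 0 - a 0) * this - (b 1 - a 1) * h
      · linear_combination (b 1 - a 1) * this + (b 0 - a 0) * h
    · rintro ⟨s, rfl⟩
      rw [hcoord, hcoord]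
      ring

/-- The two sides of a line are convex, hence connected. -/
theorem mem_connectedComponentIn_of_isLine {l : Set Plane} {F : Plane →ᵃ[ℝ] ℝ}
    (hF : ∀ x, F x = 0 ↔ x ∈ l) {x y : Plane} (h : 0 < F x * F y) :
    y ∈ connectedComponentIn lᶜ x := by
  obtain ⟨hx, hy⟩ | ⟨hx, hy⟩ := mul_pos_iff.mp h
  · refine ((convex_Ioi (0:ℝ)).affine_preimage F).isPreconnected.subset_connectedComponentIn
      hx (?_ : F ⁻¹' Ioi 0 ⊆ lᶜ) hy
    intro z hz hzl
    exact (ne_of_gt hz) ((hF z).2 hzl)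
  · refine ((convex_Iio (0:ℝ)).affine_preimage F).isPreconnected.subset_connectedComponentIn
      hx (?_ : F ⁻¹' Iio 0 ⊆ lᶜ) hy
    intro z hz hzl
    exact (ne_of_lt hz) ((hF z).2 hzl)

/-- A side function of `l`: continuous, vanishing exactly on `l`, and with the property that two
points where it has the same strict sign are not separated by `l`. -/
structure IsSideFunction (l : Set Plane) (F : Plane → ℝ) : Prop where
  continuous : Continuous F
  eq_zero_iff : ∀ x, F x = 0 ↔ x ∈ l
  mem_component : ∀ x y, 0 < F x * F y → y ∈ connectedComponentIn lᶜ x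

theorem separates_of_mul_neg {l : Set Plane} {F : Plane → ℝ} (hF : Continuous F)
    (h0 : ∀ x, F x = 0 ↔ x ∈ l) {x y : Plane} (h : F x * F y < 0) : Separates l x y := by
  have hx : F x ≠ 0 := left_ne_zero_of_mul h.ne
  have hy : F y ≠ 0 := right_ne_zero_of_mul h.ne
  have hxl : x ∉ l := fun hm => hx ((h0 x).2 hm)
  refine ⟨hxl, fun hm => hy ((h0 y).2 hm), fun hmem => ?_⟩
  have hpre : (F '' connectedComponentIn lᶜ x).OrdConnected :=
    (isPreconnected_connectedComponentIn.image F hF.continuousOn).ordConnected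
  have h1 : F x ∈ F '' connectedComponentIn lᶜ x := ⟨x, mem_connectedComponentIn hxl, rfl⟩
  have h2 : F y ∈ F '' connectedComponentIn lᶜ x := ⟨y, hmem, rfl⟩
  have h3 : (0:ℝ) ∈ F '' connectedComponentIn lᶜ x := by
    obtain ⟨ha, hb⟩ | ⟨ha, hb⟩ := mul_neg_iff.mp h
    · exact hpre.out h2 h1 ⟨hb.le, ha.le⟩
    · exact hpre.out h1 h2 ⟨ha.le, hb.le⟩
  obtain ⟨z, hz, hz0⟩ := h3
  exact connectedComponentIn_subset _ _ hz ((h0 z).1 hz0)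

theorem IsSideFunction.mul_neg_of_separates {l : Set Plane} {F : Plane → ℝ}
    (hF : IsSideFunction l F) {x y : Plane} (h : Separates l x y) : F x * F y < 0 := by
  obtain ⟨hx, hy, h⟩ := h
  have hx' : F x ≠ 0 := fun h0 => hx ((hF.eq_zero_iff x).1 h0)
  have hy' : F y ≠ 0 := fun h0 => hy ((hF.eq_zero_iff y).1 h0)
  exact lt_of_le_of_ne (not_lt.mp fun hpos => h (hF.mem_component x y hpos)) (mul_ne_zero hx' hy')

theorem exists_isSideFunction_of_isPseudoline {l : Set Plane} (hl : IsPseudoline l) :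
    ∃ F, IsSideFunction l F := by
  obtain ⟨m, hm, f, rfl⟩ := hl
  obtain ⟨-, F, hF⟩ := exists_isEmbedding_and_side_of_isLine hm
  have hc : Continuous F := F.continuous_of_finiteDimensional
  refine ⟨F ∘ f.symm, hc.comp f.symm.continuous, fun x => ?_, fun x y h => ?_⟩
  · simp only [Function.comp, hF, f.image_eq_preimage_symm, mem_preimage]
  · have h' := mem_connectedComponentIn_of_isLine hF (x := f.symm x) (y := f.symm y) h
    have := f.image_connectedComponentIn (s := mᶜ) (x := f.symm x)
      (fun hx => left_ne_zero_of_mul h.ne' ((hF _).2 hx))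
    rw [Set.image_compl_eq f.bijective, f.apply_symm_apply] at this
    rw [← this]
    exact ⟨_, h', f.apply_symm_apply y⟩

theorem exists_isEmbedding_of_isPseudoline {l : Set Plane} (hl : IsPseudoline l) :
    ∃ φ : ℝ → Plane, IsEmbedding φ ∧ range φ = l := by
  obtain ⟨m, hm, f, rfl⟩ := hl
  obtain ⟨⟨φ, hφ, rfl⟩, -⟩ := exists_isEmbedding_and_side_of_isLine hm
  exact ⟨f ∘ φ, f.isEmbedding.comp hφ, range_comp f φ⟩

theorem IsLine.isPseudoline {l : Set Plane} (hl : IsLine l) : IsPseudoline l :=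
  ⟨l, hl, Homeomorph.refl _, by simp⟩

/-- Along a parametrization, `LiesBetween` is betweenness of the parameters. -/
theorem liesBetween_range_iff {φ : ℝ → Plane} (hφ : IsEmbedding φ) (a b c : ℝ) :
    LiesBetween (range φ) (φ a) (φ c) (φ b) ↔ (a < c ∧ c < b) ∨ (b < c ∧ c < a) := by
  constructor
  · rintro ⟨-, hca, hcb, h⟩
    have hca : c ≠ a := fun e => hca (by rw [e])
    have hcb : c ≠ b := fun e => hcb (by rw [e])
    by_contra hn
    refine h ((isPreconnected_uIcc.image φ hφ.continuous.continuousOn).subset_connectedComponentIn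
      (s := φ '' uIcc a b) ⟨a, left_mem_uIcc, rfl⟩ ?_ ⟨b, right_mem_uIcc, rfl⟩)
    rintro _ ⟨x, hx, rfl⟩
    refine ⟨⟨x, rfl⟩, fun hxc => hn ?_⟩
    obtain rfl := hφ.injective hxc
    rcases mem_uIcc.mp hx with hx | hx
    · exact Or.inl ⟨lt_of_le_of_ne hx.1 hca.symm, lt_of_le_of_ne hx.2 hcb⟩
    · exact Or.inr ⟨lt_of_le_of_ne hx.1 hcb.symm, lt_of_le_of_ne hx.2 hca⟩
  · intro h
    have hca : c ≠ a := by grind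
    have hcb : c ≠ b := by grind
    have hacc : φ a ∈ range φ \ {φ c} := ⟨⟨a, rfl⟩, fun e => hca (hφ.injective e).symm⟩
    refine ⟨⟨c, rfl⟩, fun e => hca (hφ.injective e), fun e => hcb (hφ.injective e), fun hmem => ?_⟩
    set C := connectedComponentIn (range φ \ {φ c}) (φ a)
    have hC : C ⊆ range φ \ {φ c} := connectedComponentIn_subset _ _
    have himg : φ '' (φ ⁻¹' C) = C :=
      image_preimage_eq_of_subset (hC.trans sdiff_subset)
    have hpre : (φ ⁻¹' C).OrdConnected := by
      apply IsPreconnected.ordConnected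
      rw [← hφ.isInducing.isPreconnected_image, himg]
      exact isPreconnected_connectedComponentIn
    have ha : a ∈ φ ⁻¹' C := mem_connectedComponentIn hacc
    have hc : c ∈ φ ⁻¹' C := by
      rcases h with h | h
      · exact hpre.out ha hmem ⟨h.1.le, h.2.le⟩
      · exact hpre.out hmem ha ⟨h.1.le, h.2.le⟩
    exact (hC hc).2 rfl

/-! ### Rays in a half-plane -/

section HalfPlane

variable {ι : Type*} {T : ι → ι → ℝ} {r : ι → ι → Prop} {a : ι → ℝ}

/-- The rays of the curves `i` in a half-plane `H` bounded by a curve `l`. `T i j` is the position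
on the ray of `i`, measured from `l`, of the crossing with `j`, and it is negative if `i` and `j`
cross outside `H`; `r i j` says that the ray of `i` runs out to the left of the ray of `j`; and `a
i` is the position of the starting point of `i` on `l`, read from left to right. By `cross`, two
rays cross in `H` exactly if their order at infinity is not the order of their starting points; by
`side`, the side of `k` on which `i` and `j` cross is the same computed along `i` and along `j`.
-/
structure RaySystem (T : ι → ι → ℝ) (r : ι → ι → Prop) (a : ι → ℝ) : Prop where
  ne_zero : ∀ i j, i ≠ j → T i j ≠ 0
  symm : ∀ i j, i ≠ j → 0 < T i j → 0 < T j i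
  inj : ∀ i j k, i ≠ j → i ≠ k → j ≠ k → T i j ≠ T i k
  asymm : ∀ i j, i ≠ j → (r i j ↔ ¬ r j i)
  cross : ∀ i j, i ≠ j → (0 < T i j ↔ (r i j ↔ a j < a i))
  side : ∀ i j k, i ≠ j → i ≠ k → j ≠ k →
    ((T i k < T i j ↔ r i k) ↔ (T j k < T j i ↔ r j k))

/-- The order of the rays at infinity is transitive. In a cycle of three, comparing the two others
with the ray whose starting point lies between theirs contradicts `RaySystem.side`. -/
theorem RaySystem.trans (h : RaySystem T r a) {i j k : ι} (hij : i ≠ j) (hjk : j ≠ k) (hik : i ≠ k)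
    (h1 : r i j) (h2 : r j k) : r i k := by
  have c1 := h.cross i j hij
  have c2 := h.cross j k hjk
  have c3 := h.cross i k hik
  have s1 := h.side i k j hik hij hjk.symm
  have s2 := h.side i j k hij hik hjk
  have s3 := h.side j k i hjk hij.symm hik.symm
  have n1 := h.ne_zero i j hij
  have n2 := h.ne_zero k j hjk.symm
  have n3 := h.ne_zero i k hik
  have n4 := h.ne_zero k i hik.symm
  have n5 := h.ne_zero j i hij.symm
  have n6 := h.ne_zero j k hjk
  have y1 := h.symm j k hjk
  have y2 := h.symm k j hjk.symm
  have y3 := h.symm i k hik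
  have y4 := h.symm k i hik.symm
  have y5 := h.symm i j hij
  have y6 := h.symm j i hij.symm
  have a2 := h.asymm i j hij
  have a3 := h.asymm i k hik
  have a1 := h.asymm j k hjk
  grind

theorem RaySystem.exists_least [Finite ι] (h : RaySystem T r a) {S : Set ι} (hS : S.Nonempty) :
    ∃ m ∈ S, ∀ x ∈ S, x ≠ m → r m x := by
  let R : ι → ι → Prop := fun x y => x ≠ y ∧ r x y
  have : IsTrans ι R := ⟨fun x y z h1 h2 => by
    have hxz : x ≠ z := by
      rintro rfl
      exact (h.asymm _ _ h1.1).1 h1.2 h2.2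
    exact ⟨hxz, h.trans h1.1 h2.1 hxz h1.2 h2.2⟩⟩
  have : Std.Irrefl R := ⟨fun x hx => hx.1 rfl⟩
  obtain ⟨m, hm, hmin⟩ := (Finite.wellFounded_of_trans_of_irrefl R).has_min S hS
  exact ⟨m, hm, fun x hx hxm => (h.asymm m x hxm.symm).2 fun hr => hmin x hx ⟨hxm, hr⟩⟩

theorem RaySystem.exists_greatest [Finite ι] (h : RaySystem T r a) {S : Set ι} (hS : S.Nonempty) :
    ∃ m ∈ S, ∀ x ∈ S, x ≠ m → r x m := by
  let R : ι → ι → Prop := fun x y => x ≠ y ∧ r y x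
  have : IsTrans ι R := ⟨fun x y z h1 h2 => by
    have hxz : x ≠ z := by
      rintro rfl
      exact (h.asymm _ _ h1.1).1 h2.2 h1.2
    exact ⟨hxz, h.trans h2.1.symm h1.1.symm hxz.symm h2.2 h1.2⟩⟩
  have : Std.Irrefl R := ⟨fun x hx => hx.1 rfl⟩
  obtain ⟨m, hm, hmin⟩ := (Finite.wellFounded_of_trans_of_irrefl R).has_min S hS
  exact ⟨m, hm, fun x hx hxm => (h.asymm x m hxm).2 fun hr => hmin x hx ⟨hxm, hr⟩⟩

theorem RaySystem.exists_last [Finite ι] (h : RaySystem T r a) {i : ι}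
    (hi : ∃ j, i ≠ j ∧ 0 < T i j) :
    ∃ j, i ≠ j ∧ 0 < T i j ∧ ∀ k, k ≠ i → k ≠ j → T i k < T i j := by
  obtain ⟨j₀, hj₀, hpos⟩ := hi
  obtain ⟨j, hj, hmax⟩ := Set.exists_max_image {j | i ≠ j} (T i) (Set.toFinite _) ⟨j₀, hj₀⟩
  refine ⟨j, hj, hpos.trans_le (hmax j₀ hj₀), fun k hki hkj => ?_⟩
  exact lt_of_le_of_ne (hmax k hki.symm) (h.inj i k j hki.symm hj hkj)

/-- If two rays cross in the half-plane, some crossing in it is the last one on both of its rays. -/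
theorem RaySystem.exists_mutual_last [Finite ι] (h : RaySystem T r a)
    (hne : ∃ i j, i ≠ j ∧ 0 < T i j) :
    ∃ i j, i ≠ j ∧ 0 < T i j ∧ (∀ k, k ≠ i → k ≠ j → T i k < T i j) ∧
      (∀ k, k ≠ i → k ≠ j → T j k < T j i) := by
  let N : Set ι := {i | ∃ j, i ≠ j ∧ 0 < T i j}
  have hlast : ∀ i, ∃ j, i ∈ N → i ≠ j ∧ 0 < T i j ∧ ∀ k, k ≠ i → k ≠ j → T i k < T i j := by
    intro i
    by_cases hi : i ∈ N
    · obtain ⟨j, hj⟩ := h.exists_last hi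
      exact ⟨j, fun _ => hj⟩
    · exact ⟨i, fun hi' => absurd hi' hi⟩
  choose f hf using hlast
  have hfN : ∀ i ∈ N, f i ∈ N := fun i hi =>
    ⟨i, (hf i hi).1.symm, h.symm _ _ (hf i hi).1 (hf i hi).2.1⟩
  -- `b` is the greatest ray whose last crossing is with a ray to its right,
  -- and `a'` is the least ray to the right of `b` that has a crossing
  obtain ⟨m, hmN, hm⟩ := h.exists_least (S := N) hne
  obtain ⟨b, ⟨hbN, hbr⟩, hbmax⟩ := h.exists_greatest (S := {i ∈ N | r i (f i)})
    ⟨m, hmN, hm _ (hfN m hmN) (hf m hmN).1.symm⟩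
  obtain ⟨a', ⟨haN, hba, hra⟩, hamin⟩ := h.exists_least (S := {x ∈ N | b ≠ x ∧ r b x})
    ⟨f b, hfN b hbN, (hf b hbN).1, hbr⟩
  have ha2 : r (f a') a' := by
    refine (h.asymm _ _ (hf a' haN).1.symm).2 fun hr => ?_
    have := hbmax a' ⟨haN, hr⟩ hba.symm
    exact (h.asymm _ _ hba).1 hra this
  have hfb : f a' = b ∨ (f a' ≠ b ∧ r (f a') b) := by
    refine or_iff_not_imp_left.2 fun hne => ⟨hne, (h.asymm _ _ hne).2 fun h1 => ?_⟩
    have := hamin (f a') ⟨hfN a' haN, Ne.symm hne, h1⟩ (hf a' haN).1.symm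
    exact (h.asymm _ _ (hf a' haN).1).1 this ha2
  obtain ⟨c1, c2, c3⟩ := hf b hbN
  obtain ⟨d1, d2, d3⟩ := hf a' haN
  set c := f b with hc
  set d := f a' with hd
  have hac : c = a' ∨ (c ≠ a' ∧ r a' c) := by
    by_cases hca : c = a'
    · exact Or.inl hca
    · exact Or.inr ⟨hca, hamin c ⟨hfN b hbN, c1, hbr⟩ hca⟩
  -- unless `f a' = b` and `f b = a'`, some crossing lies on one side of a third ray when seen from
  -- one of its rays and on the other side when seen from the other
  rcases hfb with hfb | ⟨hdb, hfb⟩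
  · rcases hac with hac | hac
    · exact ⟨b, a', hba, hac ▸ c2, fun k hk1 hk2 => hac ▸ c3 k hk1 (hac ▸ hk2),
        fun k hk1 hk2 => hfb ▸ d3 k hk2 (hfb ▸ hk1)⟩
    · have h1 := h.asymm b a' hba
      have h2 := h.side a' b c hba.symm
      have h3 := d3 c
      have h4 := c3 a' hba.symm
      clear_value c d
      clear hf hfN hm hbmax hamin h d3 c3
      subst hfb
      exfalso
      grind
  · have e1 := h.asymm b a' hba
    have e0 := h.inj d a' b d1.symm hdb hba.symm
    have hdc : d ≠ c := by
      intro hdc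
      exact (h.asymm _ _ hdb).1 hfb (hdc ▸ hbr)
    have e2 := h.trans hdb c1 hdc hfb hbr
    have e3 := h.side a' d b d1 hba.symm hdb
    have e4 := h.side d b a' hdb d1.symm hba
    have e5 := h.side a' d c d1
    have e6 := h.side d b c hdb hdc c1
    have e7 := d3 b hba hdb.symm
    have e8 := d3 c
    have e9 := c3 d hdb hdc
    clear_value c d
    clear hf hfN hm hbmax hamin h d3 c3
    exfalso
    rcases hac with rfl | hac <;> grind

end HalfPlane

/-! ### Extreme crossings of a sided crossing system -/

variable {ι : Type*} {t : ι → ι → ℝ} {g : ι → ι → Prop}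

/-- Curve `i` has a crossing before the one with `j`. As everywhere, `t i k` is the parameter on `i`
of the crossing with `k`; the values `t i i` carry no meaning. -/
def HasBefore (t : ι → ι → ℝ) (i j : ι) : Prop := ∃ k, k ≠ i ∧ k ≠ j ∧ t i k < t i j

/-- Curve `i` has a crossing after the one with `j`. -/
def HasAfter (t : ι → ι → ℝ) (i j : ι) : Prop := ∃ k, k ≠ i ∧ k ≠ j ∧ t i j < t i k

/-- The crossing with `j` is the first or the last one on curve `i`. -/
def IsExtreme (t : ι → ι → ℝ) (i j : ι) : Prop := ¬ HasBefore t i j ∨ ¬ HasAfter t i j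

/-- No three curves meet in a point. -/
def CrossingsDistinct (t : ι → ι → ℝ) : Prop :=
  ∀ i j k, i ≠ j → i ≠ k → j ≠ k → t i j ≠ t i k

/-- The combinatorial type of an arrangement. `t i j` is the parameter on `i` of the crossing with
`j`, and `g i k` says that the branch of `i` after its crossing with `k` lies on the positive side
of `k` (the other branch then lies on the negative side). So `t i k < t i j ↔ g i k` says that the
crossing of `i` and `j` lies on the positive side of `k`, which must not depend on whether it is
read off along `i` or along `j`. -/
structure IsSidedCrossing (t : ι → ι → ℝ) (g : ι → ι → Prop) : Prop where
  inj : CrossingsDistinct t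
  side : ∀ i j k, i ≠ j → i ≠ k → j ≠ k →
    ((t i k < t i j ↔ g i k) ↔ (t j k < t j i ↔ g j k))

theorem CrossingsDistinct.exists_first [Finite ι] (h : CrossingsDistinct t) {i : ι}
    (hi : ∃ j, i ≠ j) : ∃ j, i ≠ j ∧ ∀ k, k ≠ i → k ≠ j → t i j < t i k := by
  obtain ⟨j, hj, hmin⟩ := Set.exists_min_image {j | i ≠ j} (t i) (Set.toFinite _) hi
  exact ⟨j, hj, fun k hki hkj => lt_of_le_of_ne (hmin k hki.symm) (h i j k hj hki.symm hkj.symm)⟩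

theorem CrossingsDistinct.exists_last [Finite ι] (h : CrossingsDistinct t) {i : ι}
    (hi : ∃ j, i ≠ j) : ∃ j, i ≠ j ∧ ∀ k, k ≠ i → k ≠ j → t i k < t i j := by
  obtain ⟨j, hj, hmax⟩ := Set.exists_max_image {j | i ≠ j} (t i) (Set.toFinite _) hi
  exact ⟨j, hj, fun k hki hkj => lt_of_le_of_ne (hmax k hki.symm) (h i k j hki.symm hj hkj)⟩

open Classical in
/-- The position of the crossing with `j` on `i`, measured from `l` in the direction that leads to
the positive side of `l` if `η` holds, and to the negative side if not. -/
noncomputable def rayPosition (t : ι → ι → ℝ) (g : ι → ι → Prop) (l : ι) (η : Prop) (i j : ι) : ℝ :=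
  if (g i l ↔ η) then t i j - t i l else t i l - t i j

/-- On the side `η` of `l`, the ray of `i` runs out to the left of the ray of `j`; the right side of
`j` is the one to which `l` leads. -/
def rayOrder (g : ι → ι → Prop) (l : ι) (η : Prop) (i j : ι) : Prop :=
  ¬ ((g i j ↔ (g i l ↔ η)) ↔ g l j)

/-- On the side `η` of `l` the curves other than `l` form a system of rays. The condition `cross` is
`IsSidedCrossing.side` for the crossing of `i` and `l` and the curve `j`. -/
theorem IsSidedCrossing.raySystem (h : IsSidedCrossing t g) (l : ι) (η : Prop) :
    RaySystem (ι := {i // i ≠ l}) (fun i j => rayPosition t g l η i j)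
      (fun i j => rayOrder g l η i j) (fun i => t l i) where
  ne_zero := by
    rintro ⟨i, hi⟩ ⟨j, hj⟩ hij
    have hij : i ≠ j := fun e => hij (Subtype.ext e)
    have := h.inj i j l hij hi hj
    simp only [rayPosition]
    grind
  symm := by
    rintro ⟨i, hi⟩ ⟨j, hj⟩ hij
    have hij : i ≠ j := fun e => hij (Subtype.ext e)
    have := h.inj i j l hij hi hj
    have := h.inj j i l hij.symm hj hi
    have := h.side i j l hij hi hj
    simp only [rayPosition]
    split_ifs <;> simp only [sub_pos] <;> grind
  inj := by
    rintro ⟨i, hi⟩ ⟨j, hj⟩ ⟨k, hk⟩ hij hik hjk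
    have := h.inj i j k (fun e => hij (Subtype.ext e)) (fun e => hik (Subtype.ext e))
      (fun e => hjk (Subtype.ext e))
    simp only [rayPosition]
    grind
  asymm := by
    rintro ⟨i, hi⟩ ⟨j, hj⟩ hij
    have hij : i ≠ j := fun e => hij (Subtype.ext e)
    have := h.inj i j l hij hi hj
    have := h.inj j i l hij.symm hj hi
    have := h.inj l i j hi.symm hj.symm hij
    have := h.side i j l hij hi hj
    have := h.side i l j hi hij hj.symm
    have := h.side j l i hj hij.symm hi.symm
    simp only [rayOrder]
    grind
  cross := by
    rintro ⟨i, hi⟩ ⟨j, hj⟩ hij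
    have hij : i ≠ j := fun e => hij (Subtype.ext e)
    have := h.inj i j l hij hi hj
    have := h.side i l j hi hij hj.symm
    simp only [rayOrder, rayPosition]
    split_ifs <;> simp only [sub_pos] <;> grind
  side := by
    rintro ⟨i, hi⟩ ⟨j, hj⟩ ⟨k, hk⟩ hij hik hjk
    have hij : i ≠ j := fun e => hij (Subtype.ext e)
    have hjk : j ≠ k := fun e => hjk (Subtype.ext e)
    have hik : i ≠ k := fun e => hik (Subtype.ext e)
    have := h.inj i j k hij hik hjk
    have := h.inj j i k hij.symm hjk hik
    have := h.side i j k hij hik hjk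
    simp only [rayOrder, rayPosition]
    split_ifs <;> simp only [sub_lt_sub_iff_left, sub_lt_sub_iff_right] <;> grind

theorem rayPosition_pos_iff (h : IsSidedCrossing t g) {l i j : ι} (hi : i ≠ l) (hj : j ≠ l)
    (hij : i ≠ j) (η : Prop) :
    0 < rayPosition t g l η i j ↔ ((t i l < t i j ↔ g i l) ↔ η) := by
  have := h.inj i j l hij hi hj
  simp only [rayPosition]
  split_ifs <;> simp only [sub_pos] <;> grind

theorem isExtreme_of_rayPosition {l i j : ι} {η : Prop} (hpos : 0 < rayPosition t g l η i j)
    (hlast : ∀ k, k ≠ l → k ≠ i → k ≠ j → rayPosition t g l η i k < rayPosition t g l η i j) :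
    IsExtreme t i j := by
  simp only [rayPosition] at hpos hlast
  split_ifs at hpos hlast with hg
  · refine Or.inr ?_
    rintro ⟨k, hki, hkj, hk⟩
    by_cases hkl : k = l
    · subst hkl; linarith
    · linarith [hlast k hkl hki hkj]
  · refine Or.inl ?_
    rintro ⟨k, hki, hkj, hk⟩
    by_cases hkl : k = l
    · subst hkl; linarith
    · linarith [hlast k hkl hki hkj]

/-- A side of `l` that contains a vertex contains a vertex that is an end of both of its curves. -/
theorem IsSidedCrossing.exists_isExtreme_pair [Finite ι] (h : IsSidedCrossing t g) (l : ι) (η : Prop)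
    (hne : ∃ i j, i ≠ l ∧ j ≠ l ∧ i ≠ j ∧ ((t i l < t i j ↔ g i l) ↔ η)) :
    ∃ i j, i ≠ l ∧ j ≠ l ∧ i ≠ j ∧ ((t i l < t i j ↔ g i l) ↔ η) ∧
      IsExtreme t i j ∧ IsExtreme t j i := by
  obtain ⟨i, j, hi, hj, hij, hs⟩ := hne
  obtain ⟨⟨i, hi⟩, ⟨j, hj⟩, hij, hpos, hlast, hlast'⟩ := (h.raySystem l η).exists_mutual_last
    ⟨⟨i, hi⟩, ⟨j, hj⟩, fun e => hij (congrArg Subtype.val e),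
      (rayPosition_pos_iff h hi hj hij η).2 hs⟩
  have hij' : i ≠ j := fun e => hij (Subtype.ext e)
  have hpos' := (h.raySystem l η).symm _ _ hij hpos
  refine ⟨i, j, hi, hj, hij', (rayPosition_pos_iff h hi hj hij' η).1 hpos,
    isExtreme_of_rayPosition hpos fun k hkl hki hkj => ?_,
    isExtreme_of_rayPosition hpos' fun k hkl hkj hki => ?_⟩
  · exact hlast ⟨k, hkl⟩ (fun e => hki (congrArg Subtype.val e))
      (fun e => hkj (congrArg Subtype.val e))
  · exact hlast' ⟨k, hkl⟩ (fun e => hki (congrArg Subtype.val e))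
      (fun e => hkj (congrArg Subtype.val e))

theorem injective_of_fin_three {α : Type*} {f : Fin 3 → α} (h01 : f 0 ≠ f 1) (h02 : f 0 ≠ f 2)
    (h12 : f 1 ≠ f 2) : Function.Injective f := by
  intro m m' e
  fin_cases m <;> fin_cases m' <;> first | rfl | exact absurd e ‹_› | exact absurd e.symm ‹_›

theorem IsSidedCrossing.exists_three_isExtreme_pairs [Finite ι] (h : IsSidedCrossing t g) [Nonempty ι]
    (h3 : ∀ x y : ι, ∃ z, z ≠ x ∧ z ≠ y) :
    ∃ e : Fin 3 → ι × ι, (∀ m, (e m).1 ≠ (e m).2 ∧ IsExtreme t (e m).1 (e m).2 ∧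
      IsExtreme t (e m).2 (e m).1) ∧ Function.Injective fun m => s((e m).1, (e m).2) := by
  have key : ∀ l : ι, ∃ η : Prop,
      ∃ i j, i ≠ l ∧ j ≠ l ∧ i ≠ j ∧ ((t i l < t i j ↔ g i l) ↔ η) := by
    intro l
    obtain ⟨i, hi, -⟩ := h3 l l
    obtain ⟨j, hj, hji⟩ := h3 l i
    exact ⟨_, i, j, hi, hj, hji.symm, Iff.rfl⟩
  obtain ⟨l⟩ := ‹Nonempty ι›
  obtain ⟨η, hη⟩ := key l
  obtain ⟨a, b, -, -, hab, -, hEab, hEba⟩ := h.exists_isExtreme_pair l η hη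
  by_cases hboth : ∀ η : Prop, ∃ i j, i ≠ a ∧ j ≠ a ∧ i ≠ j ∧ ((t i a < t i j ↔ g i a) ↔ η)
  · obtain ⟨i, j, hi, hj, hij, hs, hE, hE'⟩ := h.exists_isExtreme_pair a True (hboth _)
    obtain ⟨i', j', hi', hj', hij', hs', hF, hF'⟩ := h.exists_isExtreme_pair a False (hboth _)
    have hside := h.side i j a hij hi hj
    have hne1 : s(a, b) ≠ s(i, j) := by simp [hi.symm, hj.symm]
    have hne2 : s(a, b) ≠ s(i', j') := by simp [hi'.symm, hj'.symm]
    have hne3 : s(i, j) ≠ s(i', j') := by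
      intro e
      rcases Sym2.eq_iff.1 e with ⟨rfl, rfl⟩ | ⟨rfl, rfl⟩ <;> tauto
    refine ⟨![(a, b), (i, j), (i', j')], ?_,
      injective_of_fin_three hne1 hne2 hne3⟩
    · intro m
      fin_cases m
      exacts [⟨hab, hEab, hEba⟩, ⟨hij, hE, hE'⟩, ⟨hij', hF, hF'⟩]
  · obtain ⟨η', hη'⟩ := not_forall.1 hboth
    replace hη' : ∀ i j, i ≠ a → j ≠ a → i ≠ j → ¬ ((t i a < t i j ↔ g i a) ↔ η') :=
      fun i j hi hj hij hs => hη' ⟨i, j, hi, hj, hij, hs⟩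
    have hext : ∀ k, k ≠ a → IsExtreme t k a := by
      intro k hk
      by_contra hcon
      simp only [IsExtreme, not_or, not_not] at hcon
      obtain ⟨⟨x, hxk, hxa, hx⟩, ⟨y, hyk, hya, hy⟩⟩ := hcon
      have h1 := hη' k x hk hxa hxk.symm
      have h2 := hη' k y hk hya hyk.symm
      have h3 : ¬ t k a < t k x := not_lt.2 hx.le
      tauto
    obtain ⟨η, hη⟩ := key a
    obtain ⟨i, j, hi, hj, hij, -, hE, hE'⟩ := h.exists_isExtreme_pair a η hη
    obtain ⟨c, hac, hc⟩ := h.inj.exists_first ⟨b, hab⟩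
    obtain ⟨d, had, hd⟩ := h.inj.exists_last ⟨b, hab⟩
    obtain ⟨z, hza, hzc⟩ := h3 a c
    have hcd : c ≠ d := by
      rintro rfl
      exact lt_asymm (hc z hza hzc) (hd z hza hzc)
    have hne1 : s(a, c) ≠ s(a, d) := by simp [hcd, had]
    have hne2 : s(a, c) ≠ s(i, j) := by simp [hi.symm, hj.symm]
    have hne3 : s(a, d) ≠ s(i, j) := by simp [hi.symm, hj.symm]
    refine ⟨![(a, c), (a, d), (i, j)], ?_,
      injective_of_fin_three hne1 hne2 hne3⟩
    · intro m
      fin_cases m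
      · exact ⟨hac, Or.inl fun ⟨k, h1, h2, h3⟩ => lt_asymm h3 (hc k h1 h2), hext c hac.symm⟩
      · exact ⟨had, Or.inr fun ⟨k, h1, h2, h3⟩ => lt_asymm h3 (hd k h1 h2), hext d had.symm⟩
      · exact ⟨hij, hE, hE'⟩

theorem IsSidedCrossing.odd_card [Fintype ι] (h : IsSidedCrossing t g) [Nonempty ι]
    (h3 : ∀ x y : ι, ∃ z, z ≠ x ∧ z ≠ y)
    (hall : ∀ i j, i ≠ j → IsExtreme t i j → IsExtreme t j i) : Odd (Fintype.card ι) := by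
  classical
  obtain ⟨l⟩ := ‹Nonempty ι›
  obtain ⟨z, hz, -⟩ := h3 l l
  obtain ⟨a, hla, ha⟩ := h.inj.exists_first ⟨z, hz.symm⟩
  obtain ⟨b, hlb, hb⟩ := h.inj.exists_last ⟨z, hz.symm⟩
  obtain ⟨y, hyl, hya⟩ := h3 l a
  have hab : a ≠ b := by
    rintro rfl
    exact lt_asymm (ha y hyl hya) (hb y hyl hya)
  -- the side of `l` that contains the crossing of its two end curves
  set η : Prop := (t a l < t a b ↔ g a l) with hη
  have hR := h.raySystem l η
  have hN : ∀ i : {i // i ≠ l}, ∃ j : {i // i ≠ l}, i ≠ j ∧ 0 < rayPosition t g l η i j := by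
    rintro ⟨i, hi⟩
    by_cases hia : i = a
    · subst hia
      exact ⟨⟨b, hlb.symm⟩, fun e => hab (congrArg Subtype.val e),
        (rayPosition_pos_iff h hi hlb.symm hab η).2 Iff.rfl⟩
    by_cases hib : i = b
    · subst hib
      refine ⟨⟨a, hla.symm⟩, fun e => hia (congrArg Subtype.val e), ?_⟩
      exact (rayPosition_pos_iff h hi hla.symm hia η).2 (h.side a i l hab hla.symm hi).symm
    have hnot : ¬ IsExtreme t i l := by
      intro hE
      rcases hall i l hi hE with hE | hE
      · exact hE ⟨a, hla.symm, Ne.symm hia, ha i hi hia⟩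
      · exact hE ⟨b, hlb.symm, Ne.symm hib, hb i hi hib⟩
    simp only [IsExtreme, not_or, not_not] at hnot
    obtain ⟨⟨x, hxi, hxl, hx⟩, ⟨y, hyi, hyl, hy⟩⟩ := hnot
    have h1 := rayPosition_pos_iff h hi hxl hxi.symm η
    have h2 := rayPosition_pos_iff h hi hyl hyi.symm η
    have h3 : ¬ t i l < t i x := not_lt.2 hx.le
    by_cases hp : 0 < rayPosition t g l η i x
    · exact ⟨⟨x, hxl⟩, fun e => hxi (congrArg Subtype.val e).symm, hp⟩
    · refine ⟨⟨y, hyl⟩, fun e => hyi (congrArg Subtype.val e).symm, ?_⟩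
      tauto
  choose f hf using fun i => hR.exists_last (hN i)
  have hinv : ∀ i, f (f i) = i := by
    intro i
    by_contra hne
    obtain ⟨hif, hpos, hlast⟩ := hf i
    obtain ⟨hff, hpos', hlast'⟩ := hf (f i)
    have hpos2 := hR.symm _ _ hif hpos
    have hlt := hlast' i hif (Ne.symm hne)
    have hif' : (i : ι) ≠ f i := fun e => hif (Subtype.ext e)
    have hE : IsExtreme t i (f i) := isExtreme_of_rayPosition hpos fun k hkl hki hkf =>
      hlast ⟨k, hkl⟩ (fun e => hki (congrArg Subtype.val e)) (fun e => hkf (congrArg Subtype.val e))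
    have hff' : ((f (f i) : {i // i ≠ l}) : ι) ≠ f i := fun e => hff (Subtype.ext e).symm
    have hfi' : ((f (f i) : {i // i ≠ l}) : ι) ≠ i := fun e => hne (Subtype.ext e)
    simp only [rayPosition] at hpos2 hlt
    rcases hall _ _ hif' hE with hE | hE <;> split_ifs at hpos2 hlt
    · exact hE ⟨l, (f i).2.symm, i.2.symm, by linarith⟩
    · exact hE ⟨f (f i), hff', hfi', by linarith⟩
    · exact hE ⟨f (f i), hff', hfi', by linarith⟩
    · exact hE ⟨l, (f i).2.symm, i.2.symm, by linarith⟩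
  have hsum : ∑ i : {i // i ≠ l}, (1 : ZMod 2) = 0 :=
    Finset.sum_involution (fun i _ => f i) (fun i _ => by decide)
      (fun i _ _ => (hf i).1.symm) (fun i _ => Finset.mem_univ _) (fun i _ => hinv i)
  have hcard : Fintype.card {i // i ≠ l} = Fintype.card ι - 1 := by
    simp [Fintype.card_subtype_compl]
  have hpos : 0 < Fintype.card ι := Fintype.card_pos_iff.2 ⟨l⟩
  rw [Finset.sum_const, Finset.card_univ, hcard, nsmul_one, ZMod.natCast_eq_zero_iff_even] at hsum
  have := hsum.add_one
  rwa [Nat.sub_one_add_one hpos.ne'] at this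

/-! ### Counting vertices by degree -/

open Classical in
/-- The degree of the crossing of `i` and `j`: its number of neighbours on `i` and on `j`. -/
noncomputable def crossingDegree {ι : Type*} (t : ι → ι → ℝ) (i j : ι) : ℕ :=
  ((if HasBefore t i j then 1 else 0) + (if HasAfter t i j then 1 else 0)) +
    ((if HasBefore t j i then 1 else 0) + (if HasAfter t j i then 1 else 0))

/-- The pairs `(i, j)` with `i < j`, which index the crossings of `n` curves. -/
def crossingPairs (n : ℕ) : Finset (Fin n × Fin n) := Finset.univ.filter fun p => p.1 < p.2

/-- The number of crossings of degree `d`. -/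
noncomputable def degreeCount {n : ℕ} (t : Fin n → Fin n → ℝ) (d : ℕ) : ℕ :=
  ((crossingPairs n).filter fun p => crossingDegree t p.1 p.2 = d).card

theorem sum_crossingPairs {n : ℕ} (e : Fin n → Fin n → ℕ) :
    ∑ p ∈ crossingPairs n, (e p.1 p.2 + e p.2 p.1) = ∑ i, ∑ j ∈ Finset.univ.erase i, e i j := by
  have h1 : ∑ p ∈ crossingPairs n, e p.1 p.2 = ∑ i, ∑ j, if i < j then e i j else 0 := by
    rw [crossingPairs, Finset.sum_filter, ← Finset.univ_product_univ, Finset.sum_product]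
  have h2 : ∑ p ∈ crossingPairs n, e p.2 p.1 = ∑ i, ∑ j, if j < i then e i j else 0 := by
    rw [crossingPairs, Finset.sum_filter, ← Finset.univ_product_univ, Finset.sum_product,
      Finset.sum_comm]
  rw [Finset.sum_add_distrib, h1, h2, ← Finset.sum_add_distrib]
  refine Finset.sum_congr rfl fun i _ => ?_
  rw [← Finset.sum_add_distrib]
  refine (Finset.sum_erase (a := i) _ (by simp)).symm.trans (Finset.sum_congr rfl fun j hj => ?_)
  rcases lt_or_gt_of_ne (Finset.ne_of_mem_erase hj) with h | h <;> simp [h, h.le, not_lt.2]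

theorem two_mul_card_crossingPairs (n : ℕ) : 2 * (crossingPairs n).card = n * (n - 1) := by
  have := sum_crossingPairs (n := n) (fun _ _ => 1)
  simp at this
  omega

section

variable {n : ℕ} {t : Fin n → Fin n → ℝ}

theorem exists_ne_ne (hn : 3 ≤ n) (x y : Fin n) : ∃ z, z ≠ x ∧ z ≠ y := by
  obtain ⟨z, hz⟩ := Finset.exists_mem_notMem_of_card_lt_card (s := {x, y}) (t := Finset.univ)
    (lt_of_le_of_lt Finset.card_le_two (by rw [Finset.card_univ, Fintype.card_fin]; exact hn))
  exact ⟨z, by simpa [not_or] using hz⟩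

theorem hasBefore_or_hasAfter (ht : CrossingsDistinct t) (hn : 3 ≤ n) {i j : Fin n} (hij : i ≠ j) :
    HasBefore t i j ∨ HasAfter t i j := by
  obtain ⟨k, hki, hkj⟩ := exists_ne_ne hn i j
  rcases lt_or_gt_of_ne (ht i j k hij hki.symm hkj.symm) with h | h
  · exact Or.inr ⟨k, hki, hkj, h⟩
  · exact Or.inl ⟨k, hki, hkj, h⟩

theorem crossingDegree_eq_two_iff (ht : CrossingsDistinct t) (hn : 3 ≤ n) {i j : Fin n}
    (hij : i ≠ j) : crossingDegree t i j = 2 ↔ IsExtreme t i j ∧ IsExtreme t j i := by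
  have h1 := hasBefore_or_hasAfter ht hn hij
  have h2 := hasBefore_or_hasAfter ht hn hij.symm
  unfold crossingDegree IsExtreme
  split_ifs <;> simp_all

theorem crossingDegree_comm {ι : Type*} (t : ι → ι → ℝ) (i j : ι) :
    crossingDegree t i j = crossingDegree t j i := add_comm _ _

theorem crossingDegree_eq_three (ht : CrossingsDistinct t) (hn : 3 ≤ n) {i j : Fin n}
    (hij : i ≠ j) (h : IsExtreme t i j) (h' : ¬ IsExtreme t j i) : crossingDegree t i j = 3 := by
  have h1 := hasBefore_or_hasAfter ht hn hij
  unfold crossingDegree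
  unfold IsExtreme at h h'
  split_ifs <;> simp_all

theorem crossingDegree_mem (ht : CrossingsDistinct t) (hn : 3 ≤ n) {i j : Fin n}
    (hij : i ≠ j) :
    crossingDegree t i j = 2 ∨ crossingDegree t i j = 3 ∨ crossingDegree t i j = 4 := by
  have h1 := hasBefore_or_hasAfter ht hn hij
  have h2 := hasBefore_or_hasAfter ht hn hij.symm
  unfold crossingDegree
  split_ifs <;> simp_all

open Classical in
theorem sum_ite_hasBefore (ht : CrossingsDistinct t) (hn : 3 ≤ n) (i : Fin n) :
    ∑ j ∈ Finset.univ.erase i, (if HasBefore t i j then 0 else 1) = 1 := by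
  obtain ⟨z, hz, -⟩ := exists_ne_ne hn i i
  obtain ⟨j, hij, hj⟩ := ht.exists_first ⟨z, hz.symm⟩
  rw [Finset.sum_eq_single_of_mem j (by simpa using hij.symm)]
  · exact if_neg fun ⟨k, h1, h2, h3⟩ => lt_asymm h3 (hj k h1 h2)
  · intro k hk hkj
    have hki := Finset.ne_of_mem_erase hk
    exact if_pos ⟨j, hij.symm, hkj.symm, hj k hki hkj⟩

open Classical in
theorem sum_ite_hasAfter (ht : CrossingsDistinct t) (hn : 3 ≤ n) (i : Fin n) :
    ∑ j ∈ Finset.univ.erase i, (if HasAfter t i j then 0 else 1) = 1 := by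
  obtain ⟨z, hz, -⟩ := exists_ne_ne hn i i
  obtain ⟨j, hij, hj⟩ := ht.exists_last ⟨z, hz.symm⟩
  rw [Finset.sum_eq_single_of_mem j (by simpa using hij.symm)]
  · exact if_neg fun ⟨k, h1, h2, h3⟩ => lt_asymm h3 (hj k h1 h2)
  · intro k hk hkj
    have hki := Finset.ne_of_mem_erase hk
    exact if_pos ⟨j, hij.symm, hkj.symm, hj k hki hkj⟩

theorem ne_of_mem_crossingPairs {p : Fin n × Fin n} (hp : p ∈ crossingPairs n) : p.1 ≠ p.2 :=
  (Finset.mem_filter.1 hp).2.ne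

/-- Every curve has two ends, and a vertex of degree `4 - k` is an end of `k` curves. -/
theorem degreeCount_three_add (ht : CrossingsDistinct t) (hn : 3 ≤ n) :
    degreeCount t 3 + 2 * degreeCount t 2 = 2 * n := by
  classical
  have h := sum_crossingPairs (n := n) (fun i j => (if HasBefore t i j then 0 else 1) +
    (if HasAfter t i j then 0 else 1))
  simp only [Finset.sum_add_distrib (f := fun j => (if HasBefore t _ j then 0 else 1)),
    sum_ite_hasBefore ht hn, sum_ite_hasAfter ht hn] at h
  rw [Finset.sum_const, Finset.card_univ, Fintype.card_fin, smul_eq_mul, mul_comm] at h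
  rw [← h, degreeCount, degreeCount, Finset.card_filter, Finset.card_filter, Finset.mul_sum,
    ← Finset.sum_add_distrib]
  refine Finset.sum_congr rfl fun p hp => ?_
  have h1 := hasBefore_or_hasAfter ht hn (ne_of_mem_crossingPairs hp)
  have h2 := hasBefore_or_hasAfter ht hn (ne_of_mem_crossingPairs hp).symm
  unfold crossingDegree
  by_cases a : HasBefore t p.1 p.2 <;> by_cases b : HasAfter t p.1 p.2 <;>
    by_cases c : HasBefore t p.2 p.1 <;> by_cases d : HasAfter t p.2 p.1 <;> simp_all

theorem degreeCount_sum (ht : CrossingsDistinct t) (hn : 3 ≤ n) :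
    degreeCount t 2 + degreeCount t 3 + degreeCount t 4 = (crossingPairs n).card := by
  rw [degreeCount, degreeCount, degreeCount, Finset.card_filter, Finset.card_filter,
    Finset.card_filter, ← Finset.sum_add_distrib, ← Finset.sum_add_distrib, Finset.card_eq_sum_ones]
  refine Finset.sum_congr rfl fun p hp => ?_
  rcases crossingDegree_mem ht hn (ne_of_mem_crossingPairs hp) with h | h | h <;> simp [h]

theorem degreeCount_eq_zero (ht : CrossingsDistinct t) (hn : 3 ≤ n) {d : ℕ} (h2 : d ≠ 2)
    (h3 : d ≠ 3) (h4 : d ≠ 4) : degreeCount t d = 0 := by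
  rw [degreeCount, Finset.card_eq_zero, Finset.filter_eq_empty_iff]
  intro p hp
  rcases crossingDegree_mem ht hn (ne_of_mem_crossingPairs hp) with h | h | h <;> omega

theorem IsSidedCrossing.three_le_degreeCount_two {g : Fin n → Fin n → Prop}
    (h : IsSidedCrossing t g) (hn : 3 ≤ n) : 3 ≤ degreeCount t 2 := by
  have : Nonempty (Fin n) := ⟨⟨0, by omega⟩⟩
  obtain ⟨e, he, hinj⟩ := h.exists_three_isExtreme_pairs (exists_ne_ne hn)
  let f : Fin 3 → Fin n × Fin n := fun m => (min (e m).1 (e m).2, max (e m).1 (e m).2)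
  have hfs : ∀ m, s((f m).1, (f m).2) = s((e m).1, (e m).2) := by
    intro m
    rcases le_total (e m).1 (e m).2 with h | h <;> simp [f, h, Sym2.eq_swap]
  have hf : Function.Injective f := fun a b hab => hinj (by
    change s((e a).1, (e a).2) = s((e b).1, (e b).2)
    rw [← hfs, ← hfs, hab])
  calc 3 = (Finset.univ.image f).card := by rw [Finset.card_image_of_injective _ hf]; simp
    _ ≤ degreeCount t 2 := by
      refine Finset.card_le_card fun p hp => ?_
      obtain ⟨m, -, rfl⟩ := Finset.mem_image.1 hp
      obtain ⟨hne, hE, hE'⟩ := he m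
      rw [Finset.mem_filter, crossingPairs, Finset.mem_filter]
      refine ⟨⟨Finset.mem_univ _, min_lt_max.2 hne⟩, ?_⟩
      rcases le_total (e m).1 (e m).2 with h' | h' <;>
        simp only [f, h', min_eq_left, min_eq_right, max_eq_left, max_eq_right]
      · exact (crossingDegree_eq_two_iff h.inj hn hne).2 ⟨hE, hE'⟩
      · exact (crossingDegree_eq_two_iff h.inj hn hne.symm).2 ⟨hE', hE⟩

theorem IsSidedCrossing.odd_of_degreeCount_two_eq {g : Fin n → Fin n → Prop}
    (h : IsSidedCrossing t g) (hn : 3 ≤ n) (h2 : degreeCount t 2 = n) : Odd n := by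
  have : Nonempty (Fin n) := ⟨⟨0, by omega⟩⟩
  have h3 : degreeCount t 3 = 0 := by
    have := degreeCount_three_add h.inj hn
    omega
  rw [degreeCount, Finset.card_eq_zero, Finset.filter_eq_empty_iff] at h3
  have hall : ∀ i j, i ≠ j → IsExtreme t i j → IsExtreme t j i := by
    intro i j hij hE
    by_contra hE'
    have hd := crossingDegree_eq_three h.inj hn hij hE hE'
    rcases lt_or_gt_of_ne hij with hlt | hlt
    · exact h3 (x := (i, j)) (Finset.mem_filter.2 ⟨Finset.mem_univ _, hlt⟩) hd
    · exact h3 (x := (j, i)) (Finset.mem_filter.2 ⟨Finset.mem_univ _, hlt⟩)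
        ((crossingDegree_comm t j i).trans hd)
  simpa using h.odd_card (exists_ne_ne hn) hall

end

/-! ### The degrees of the arrangement graph -/

open Classical in
/-- There is at most one crossing next to the one with `j` and before it on `i`. -/
theorem encard_nearest_before {ι : Type*} [Finite ι] {t : ι → ι → ℝ} (ht : CrossingsDistinct t)
    {i j : ι} (hij : i ≠ j) :
    {k | k ≠ i ∧ k ≠ j ∧ t i k < t i j ∧ ∀ m, m ≠ i → ¬ (t i k < t i m ∧ t i m < t i j)}.encard
      = ((if HasBefore t i j then 1 else 0 : ℕ) : ℕ∞) := by
  split_ifs with h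
  · obtain ⟨k, hk, hmax⟩ := Set.exists_max_image {k | k ≠ i ∧ k ≠ j ∧ t i k < t i j} (t i)
      (Set.toFinite _) h
    rw [Nat.cast_one, Set.encard_eq_one]
    refine ⟨k, Set.eq_singleton_iff_unique_mem.2 ⟨⟨hk.1, hk.2.1, hk.2.2, ?_⟩, ?_⟩⟩
    · rintro m hm ⟨h1, h2⟩
      have hmj : m ≠ j := by
        rintro rfl
        exact lt_irrefl _ h2
      exact (hmax m ⟨hm, hmj, h2⟩).not_gt h1
    · rintro m ⟨hmi, hmj, hmlt, hm⟩
      by_contra hmk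
      refine hm k hk.1 ⟨lt_of_le_of_ne (hmax m ⟨hmi, hmj, hmlt⟩) ?_, hk.2.2⟩
      exact ht i m k hmi.symm hk.1.symm hmk
  · rw [Nat.cast_zero, Set.encard_eq_zero, Set.eq_empty_iff_forall_notMem]
    rintro k ⟨h1, h2, h3, -⟩
    exact h ⟨k, h1, h2, h3⟩

open Classical in
theorem encard_nearest {ι : Type*} [Finite ι] {t : ι → ι → ℝ} (ht : CrossingsDistinct t)
    {i j : ι} (hij : i ≠ j) :
    {k | k ≠ i ∧ k ≠ j ∧ ∀ m, m ≠ i →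
      ¬ ((t i j < t i m ∧ t i m < t i k) ∨ (t i k < t i m ∧ t i m < t i j))}.encard
      = (((if HasBefore t i j then 1 else 0) + (if HasAfter t i j then 1 else 0) : ℕ) : ℕ∞) := by
  have h1 := encard_nearest_before ht hij
  have h2 := encard_nearest_before (t := fun i j => - t i j)
    (fun i j k hij hik hjk h => ht i j k hij hik hjk (neg_injective h)) hij
  have h3 : HasBefore (fun i j => - t i j) i j ↔ HasAfter t i j := by
    simp [HasBefore, HasAfter]
  rw [if_congr h3 rfl rfl] at h2
  rw [Nat.cast_add, ← h1, ← h2, ← Set.encard_union_eq]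
  · congr 1
    ext k
    simp only [mem_ofPred_eq, mem_union, neg_lt_neg_iff]
    constructor
    · rintro ⟨hki, hkj, hk⟩
      rcases lt_or_gt_of_ne (ht i k j hki.symm hij hkj) with h | h
      · exact Or.inl ⟨hki, hkj, h, fun m hm hc => hk m hm (Or.inr hc)⟩
      · exact Or.inr ⟨hki, hkj, h, fun m hm hc => hk m hm (Or.inl hc.symm)⟩
    · rintro (⟨hki, hkj, h, hk⟩ | ⟨hki, hkj, h, hk⟩)
      · refine ⟨hki, hkj, fun m hm hc => ?_⟩
        rcases hc with hc | hc
        · exact lt_asymm h (hc.1.trans hc.2)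
        · exact hk m hm hc
      · refine ⟨hki, hkj, fun m hm hc => ?_⟩
        rcases hc with hc | hc
        · exact hk m hm hc.symm
        · exact lt_asymm h (hc.1.trans hc.2)
  · rw [Set.disjoint_left]
    rintro k ⟨-, -, h, -⟩ ⟨-, -, h', -⟩
    exact lt_asymm h (neg_lt_neg_iff.1 h')

/-- The curves `φ i` are embedded lines of which any two meet exactly once, with no three through a
point, and `t i j` is the parameter on `φ i` of the point on `φ j`. -/
structure IsCurveFamily {n : ℕ} (φ : Fin n → ℝ → Plane) (t : Fin n → Fin n → ℝ) : Prop where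
  isEmbedding : ∀ i, IsEmbedding (φ i)
  meet : ∀ i j, i ≠ j → φ i (t i j) = φ j (t j i)
  eq_of_meet : ∀ i j, i ≠ j → ∀ a b, φ i a = φ j b → a = t i j
  distinct : CrossingsDistinct t

namespace IsCurveFamily

variable {n : ℕ} {φ : Fin n → ℝ → Plane} {t : Fin n → Fin n → ℝ}

theorem eq_of_mem_range (h : IsCurveFamily φ t) {i j m : Fin n} (hij : i ≠ j)
    (hm : φ i (t i j) ∈ range (φ m)) : m = i ∨ m = j := by
  obtain ⟨b, hb⟩ := hm
  by_contra! hcon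
  exact h.distinct i j m hij hcon.1.symm hcon.2.symm (h.eq_of_meet i m hcon.1.symm _ _ hb.symm)

theorem range_injective (h : IsCurveFamily φ t) : Function.Injective fun i => range (φ i) := by
  intro i j hij
  by_contra hne
  have key : ∀ a, a = t i j := by
    intro a
    obtain ⟨b, hb⟩ : φ i a ∈ range (φ j) := (show range (φ i) = range (φ j) from hij) ▸ ⟨a, rfl⟩
    exact h.eq_of_meet i j hne a b hb.symm
  exact zero_ne_one ((key 0).trans (key 1).symm)

theorem mem_vertices (h : IsCurveFamily φ t) {i j : Fin n} (hij : i ≠ j) :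
    φ i (t i j) ∈ vertices (range fun i => range (φ i)) :=
  ⟨_, ⟨i, rfl⟩, _, ⟨j, rfl⟩, fun e => hij (h.range_injective e), ⟨_, rfl⟩, h.meet i j hij ▸ ⟨_, rfl⟩⟩

theorem exists_of_mem_vertices (h : IsCurveFamily φ t) {x : Plane}
    (hx : x ∈ vertices (range fun i => range (φ i))) : ∃ i j, i ≠ j ∧ x = φ i (t i j) := by
  obtain ⟨_, ⟨i, rfl⟩, _, ⟨j, rfl⟩, hne, ⟨a, rfl⟩, ⟨b, hb⟩⟩ := hx
  have hij : i ≠ j := fun e => hne (by rw [e])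
  exact ⟨i, j, hij, by rw [h.eq_of_meet i j hij a b hb.symm]⟩

theorem mem_vertices_iff (h : IsCurveFamily φ t) (i : Fin n) (a : ℝ) :
    φ i a ∈ vertices (range fun i => range (φ i)) ↔ ∃ k, k ≠ i ∧ a = t i k := by
  constructor
  · intro hx
    obtain ⟨j, k, hjk, e⟩ := h.exists_of_mem_vertices hx
    by_cases hij : i = j
    · subst hij
      exact ⟨k, hjk.symm, (h.isEmbedding i).injective e⟩
    · exact ⟨j, Ne.symm hij, h.eq_of_meet i j hij _ _ e⟩
  · rintro ⟨k, hk, rfl⟩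
    exact h.mem_vertices hk.symm

/-- The vertices correspond to the pairs of curves. -/
noncomputable def vertexEquiv (h : IsCurveFamily φ t) :
    crossingPairs n ≃ vertices (range fun i => range (φ i)) :=
  Equiv.ofBijective (fun p => ⟨φ p.1.1 (t p.1.1 p.1.2),
    h.mem_vertices (ne_of_mem_crossingPairs p.2)⟩) (by
    constructor
    · rintro ⟨⟨i, j⟩, hp⟩ ⟨⟨i', j'⟩, hp'⟩ e
      have hij : i < j := (Finset.mem_filter.1 hp).2
      have hij' : i' < j' := (Finset.mem_filter.1 hp').2
      have e : φ i (t i j) = φ i' (t i' j') := congrArg Subtype.val e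
      have h1 := h.eq_of_mem_range hij.ne (m := i') (e ▸ ⟨_, rfl⟩)
      have h2 := h.eq_of_mem_range hij'.ne (m := i) (e ▸ ⟨_, rfl⟩)
      have h3 := h.eq_of_mem_range hij.ne (m := j') (e ▸ h.meet i' j' hij'.ne ▸ ⟨_, rfl⟩)
      have : i = i' ∧ j = j' := by omega
      simp [this]
    · rintro ⟨x, hx⟩
      obtain ⟨i, j, hij, rfl⟩ := h.exists_of_mem_vertices hx
      rcases lt_or_gt_of_ne hij with hlt | hlt
      · exact ⟨⟨(i, j), Finset.mem_filter.2 ⟨Finset.mem_univ _, hlt⟩⟩, rfl⟩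
      · exact ⟨⟨(j, i), Finset.mem_filter.2 ⟨Finset.mem_univ _, hlt⟩⟩,
          Subtype.ext (h.meet j i hij.symm)⟩)

/-- The neighbours of a vertex are the vertices next to it on its two curves. -/
theorem image_neighborSet (h : IsCurveFamily φ t) {i j : Fin n} (hij : i ≠ j) :
    Subtype.val '' (arrangementGraph (range fun i => range (φ i))).neighborSet
      ⟨φ i (t i j), h.mem_vertices hij⟩ =
    (fun k => φ i (t i k)) '' {k | k ≠ i ∧ k ≠ j ∧ ∀ m, m ≠ i →
      ¬ ((t i j < t i m ∧ t i m < t i k) ∨ (t i k < t i m ∧ t i m < t i j))} ∪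
    (fun k => φ j (t j k)) '' {k | k ≠ j ∧ k ≠ i ∧ ∀ m, m ≠ j →
      ¬ ((t j i < t j m ∧ t j m < t j k) ∨ (t j k < t j m ∧ t j m < t j i))} := by
  have key : ∀ (i j : Fin n) (hij : i ≠ j) (v : vertices (range fun i => range (φ i))),
      ((v : Plane) ≠ φ i (t i j) ∧ (v : Plane) ∈ range (φ i) ∧
        ∀ w ∈ vertices (range fun i => range (φ i)), ¬ LiesBetween (range (φ i)) (φ i (t i j)) w v) ↔
      (v : Plane) ∈ (fun k => φ i (t i k)) '' {k | k ≠ i ∧ k ≠ j ∧ ∀ m, m ≠ i →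
      ¬ ((t i j < t i m ∧ t i m < t i k) ∨ (t i k < t i m ∧ t i m < t i j))} := by
    rintro i j hij ⟨v, hv⟩
    constructor
    · rintro ⟨hne, ⟨a, rfl⟩, hbetween⟩
      obtain ⟨k, hki, rfl⟩ := (h.mem_vertices_iff i a).1 hv
      refine ⟨k, ⟨hki, fun e => hne (congrArg (fun k => φ i (t i k)) e), fun m hm hc => ?_⟩, rfl⟩
      exact hbetween _ (h.mem_vertices hm.symm) ((liesBetween_range_iff (h.isEmbedding i) _ _ _).2 hc)
    · rintro ⟨k, ⟨hki, hkj, hk⟩, rfl⟩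
      refine ⟨fun e => ?_, ⟨_, rfl⟩, fun w hw hb => ?_⟩
      · exact h.distinct i k j hki.symm hij hkj ((h.isEmbedding i).injective e)
      · obtain ⟨b, rfl⟩ := hb.1
        obtain ⟨m, hm, rfl⟩ := (h.mem_vertices_iff i b).1 hw
        exact hk m hm ((liesBetween_range_iff (h.isEmbedding i) _ _ _).1 hb)
  ext x
  constructor
  · rintro ⟨v, ⟨hne, _, ⟨m, rfl⟩, hm, hv, hb⟩, rfl⟩
    have hne' : (v : Plane) ≠ φ i (t i j) := fun e => hne (Subtype.ext e.symm)
    rcases h.eq_of_mem_range hij hm with rfl | rfl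
    · exact Or.inl ((key _ _ hij v).1 ⟨hne', hv, hb⟩)
    · refine Or.inr ((key _ _ hij.symm v).1 ⟨?_, hv, ?_⟩)
      · rwa [← h.meet _ _ hij]
      · rwa [← h.meet _ _ hij]
  · intro hx
    have hxv : x ∈ vertices (range fun i => range (φ i)) := by
      rcases hx with ⟨k, hk, rfl⟩ | ⟨k, hk, rfl⟩ <;> exact h.mem_vertices hk.1.symm
    refine ⟨⟨x, hxv⟩, ?_, rfl⟩
    rcases hx with hx | hx
    · obtain ⟨h1, h2, h3⟩ := (key _ _ hij ⟨x, hxv⟩).2 hx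
      exact ⟨fun e => h1 (congrArg Subtype.val e).symm, _, ⟨i, rfl⟩, ⟨_, rfl⟩, h2, h3⟩
    · obtain ⟨h1, h2, h3⟩ := (key _ _ hij.symm ⟨x, hxv⟩).2 hx
      rw [← h.meet _ _ hij] at h1 h3
      exact ⟨fun e => h1 (congrArg Subtype.val e).symm, _, ⟨j, rfl⟩,
        ⟨_, (h.meet _ _ hij).symm⟩, h2, h3⟩

theorem encard_neighborSet (h : IsCurveFamily φ t) {i j : Fin n} (hij : i ≠ j) :
    ((arrangementGraph (range fun i => range (φ i))).neighborSet
      ⟨φ i (t i j), h.mem_vertices hij⟩).encard = crossingDegree t i j := by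
  classical
  have hinj : ∀ i : Fin n, InjOn (fun k => φ i (t i k)) {k | k ≠ i} := by
    intro i k hk k' hk' e
    by_contra hne
    exact h.distinct i k k' (Ne.symm hk) (Ne.symm hk') hne ((h.isEmbedding i).injective e)
  rw [← Subtype.val_injective.encard_image, h.image_neighborSet hij, Set.encard_union_eq,
    ((hinj i).mono fun k hk => hk.1).encard_image, ((hinj j).mono fun k hk => hk.1).encard_image,
    encard_nearest h.distinct hij, encard_nearest h.distinct hij.symm, crossingDegree]
  · push_cast
    rfl
  · rw [Set.disjoint_left]
    rintro _ ⟨k, ⟨hki, hkj, -⟩, rfl⟩ ⟨m, -, e⟩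
    exact h.distinct i k j hki.symm hij hkj (h.eq_of_meet i j hij _ _ e.symm)

/-- A sorted list is the degree sequence exactly if it has the right multiplicities. -/
theorem isDegreeSequence_iff (h : IsCurveFamily φ t) (π : List ℕ) (hπ : π.Pairwise (· ≥ ·)) :
    IsDegreeSequence (arrangementGraph (range fun i => range (φ i))) π ↔
      ∀ d, π.count d = degreeCount t d := by
  classical
  have hcount : ∀ d, Fintype.card {m : Fin π.length // π.get m = d} = π.count d := by
    intro d
    rw [Fintype.card_subtype]
    exact Fin.card_filter_univ_eq_vector_get_eq_count d ⟨π, rfl⟩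
  have hdeg : ∀ d, Fintype.card {p : crossingPairs n // crossingDegree t p.1.1 p.1.2 = d}
      = degreeCount t d := by
    intro d
    rw [degreeCount, ← Fintype.card_coe]
    exact Fintype.card_congr ((Equiv.subtypeSubtypeEquivSubtypeInter (· ∈ crossingPairs n)
      fun p => crossingDegree t p.1 p.2 = d).trans (Equiv.subtypeEquivRight (by simp)))
  have hnb : ∀ p, ((arrangementGraph (range fun i => range (φ i))).neighborSet
      (h.vertexEquiv p)).encard = crossingDegree t p.1.1 p.1.2 :=
    fun p => h.encard_neighborSet (ne_of_mem_crossingPairs p.2)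
  constructor
  · rintro ⟨-, e, he⟩ d
    rw [← hcount, ← hdeg]
    refine Fintype.card_congr ((e.trans h.vertexEquiv.symm).subtypeEquiv fun m => ?_)
    have := he m
    rw [← h.vertexEquiv.apply_symm_apply (e m), hnb, Nat.cast_inj] at this
    rw [← this]
    rfl
  · intro hc
    let E : ∀ d, {m : Fin π.length // π.get m = d} ≃
        {p : crossingPairs n // crossingDegree t p.1.1 p.1.2 = d} := fun d =>
      Fintype.equivOfCardEq (by rw [hcount, hdeg, hc])
    refine ⟨hπ, (Equiv.ofFiberEquiv E).trans h.vertexEquiv, fun m => ?_⟩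
    rw [Equiv.trans_apply, hnb, Nat.cast_inj]
    exact Equiv.ofFiberEquiv_map E m

end IsCurveFamily

/-! ### Pseudoline arrangements satisfy the degree condition -/

theorem pairwise_replicate_append (d₂ d₃ d₄ : ℕ) :
    (List.replicate d₄ 4 ++ List.replicate d₃ 3 ++ List.replicate d₂ 2).Pairwise (· ≥ ·) := by
  simp only [List.pairwise_append, List.pairwise_replicate, List.mem_append, List.mem_replicate]
  grind

section

variable {n : ℕ} {t : Fin n → Fin n → ℝ}

theorem degreeCount_three_cast (ht : CrossingsDistinct t) (hn : 3 ≤ n) :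
    (degreeCount t 3 : ℝ) = 2 * ((n : ℝ) - degreeCount t 2) := by
  have h : (degreeCount t 3 : ℝ) + 2 * degreeCount t 2 = 2 * n := by
    exact_mod_cast degreeCount_three_add ht hn
  linarith

theorem degreeCount_four_cast (ht : CrossingsDistinct t) (hn : 3 ≤ n) :
    (degreeCount t 4 : ℝ) = (n : ℝ) * ((n : ℝ) - 5) / 2 + degreeCount t 2 := by
  have h2 : (degreeCount t 2 : ℝ) + degreeCount t 3 + degreeCount t 4 =
      (crossingPairs n).card := by
    exact_mod_cast degreeCount_sum ht hn
  have h3 : 2 * ((crossingPairs n).card : ℝ) = n * (n - 1) := by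
    have := congrArg (Nat.cast : ℕ → ℝ) (two_mul_card_crossingPairs n)
    rwa [Nat.cast_mul, Nat.cast_mul, Nat.cast_sub (by omega), Nat.cast_one, Nat.cast_two] at this
  have := degreeCount_three_cast ht hn
  linarith

theorem degreeCount_eq_count (ht : CrossingsDistinct t) (hn : 3 ≤ n) (d : ℕ) :
    degreeCount t d = (List.replicate (degreeCount t 4) 4 ++ List.replicate (degreeCount t 3) 3 ++
      List.replicate (degreeCount t 2) 2).count d := by
  simp only [List.count_append, List.count_replicate]
  by_cases e2 : d = 2
  · simp [e2]
  by_cases e3 : d = 3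
  · simp [e3]
  by_cases e4 : d = 4
  · simp [e4]
  simp [degreeCount_eq_zero ht hn e2 e3 e4, Ne.symm e2, Ne.symm e3, Ne.symm e4]

theorem IsCurveFamily.degreeCondition {φ : Fin n → ℝ → Plane}
    {g : Fin n → Fin n → Prop} (h : IsCurveFamily φ t) (hg : IsSidedCrossing t g) (hn : 3 ≤ n)
    {π : List ℕ} (hπ : IsDegreeSequence (arrangementGraph (range fun i => range (φ i))) π) :
    DegreeCondition π := by
  have hcount := (h.isDegreeSequence_iff π hπ.1).1 hπ
  have h1 := degreeCount_three_add h.distinct hn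
  refine ⟨n, degreeCount t 2, degreeCount t 3, degreeCount t 4, hn,
    ⟨?_, hg.three_le_degreeCount_two hn, by omega, degreeCount_three_cast h.distinct hn,
      degreeCount_four_cast h.distinct hn⟩, hg.odd_of_degreeCount_two_eq hn⟩
  have hperm := List.perm_iff_count.2 fun d =>
    (hcount d).trans (degreeCount_eq_count h.distinct hn d)
  exact hperm.eq_of_pairwise (fun a b _ _ h1 h2 => le_antisymm h2 h1) hπ.1
    (pairwise_replicate_append _ _ _)

theorem IsCurveFamily.isDegreeSequence {φ : Fin n → ℝ → Plane}
    (h : IsCurveFamily φ t) (hn : 3 ≤ n) {d₃ d₄ : ℕ}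
    (h3 : (d₃ : ℝ) = 2 * ((n : ℝ) - degreeCount t 2))
    (h4 : (d₄ : ℝ) = (n : ℝ) * ((n : ℝ) - 5) / 2 + degreeCount t 2) :
    IsDegreeSequence (arrangementGraph (range fun i => range (φ i)))
      (List.replicate d₄ 4 ++ List.replicate d₃ 3 ++ List.replicate (degreeCount t 2) 2) := by
  have e3 : d₃ = degreeCount t 3 := by
    exact_mod_cast h3.trans (degreeCount_three_cast h.distinct hn).symm
  have e4 : d₄ = degreeCount t 4 := by
    exact_mod_cast h4.trans (degreeCount_four_cast h.distinct hn).symm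
  rw [h.isDegreeSequence_iff _ (pairwise_replicate_append _ _ _), e3, e4]
  exact fun d => (degreeCount_eq_count h.distinct hn d).symm

end

theorem IsSimpleArrangement.mono {P Q : Set Plane → Prop} {L : Set (Set Plane)}
    (h : IsSimpleArrangement P L) (hPQ : ∀ l, P l → Q l) : IsSimpleArrangement Q L :=
  ⟨h.three_le, fun l hl => hPQ l (h.kind l hl), h.cross, h.simple⟩

/-- The vertices on one member determine the other members. -/
theorem IsSimpleArrangement.finite {P : Set Plane → Prop} {L : Set (Set Plane)}
    (h : IsSimpleArrangement P L) (hv : (vertices L).Finite) : L.Finite := by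
  by_contra hinf
  obtain ⟨l₀, hl₀⟩ : L.Nonempty := by
    rw [Set.nonempty_iff_ne_empty]
    rintro rfl
    exact hinf Set.finite_empty
  have hp : ∀ l, ∃ p : Plane, l ∈ L \ {l₀} → l₀ ∩ l = {p} := by
    intro l
    by_cases hl : l ∈ L \ {l₀}
    · obtain ⟨p, hp⟩ := (h.cross l₀ hl₀ l hl.1 (Ne.symm hl.2)).1
      exact ⟨p, fun _ => hp⟩
    · exact ⟨0, fun hl' => absurd hl' hl⟩
  choose p hp using hp
  have hmem : ∀ l ∈ L \ {l₀}, p l ∈ l₀ ∩ l := fun l hl => by rw [hp l hl]; rfl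
  refine hinf (((hv.of_injOn (f := p) (s := L \ {l₀}) ?_ ?_).insert l₀).subset ?_)
  · exact fun l hl => ⟨l₀, hl₀, l, hl.1, Ne.symm hl.2, hmem l hl⟩
  · intro l hl l' hl' e
    by_contra hne
    have : p l ∈ l₀ ∩ l ∩ l' := ⟨hmem l hl, e ▸ (hmem l' hl').2⟩
    rw [h.simple l₀ hl₀ l hl.1 l' hl'.1 (Ne.symm hl.2) (Ne.symm hl'.2) hne] at this
    exact this
  · intro l hl
    by_cases e : l = l₀
    · exact Or.inl e
    · exact Or.inr ⟨hl, e⟩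

/-- A continuous function with a single zero that takes both signs changes sign at the zero. -/
theorem exists_side_iff {f : ℝ → ℝ} (hf : Continuous f) {c : ℝ} (hc : ∀ x, f x = 0 → x = c)
    (hsign : ∃ x y, f x * f y < 0) (hc0 : f c = 0):
    ∃ s : Prop, ∀ x, x ≠ c → (0 < f x ↔ (c < x ↔ s)) := by
  have hne : ∀ x, x ≠ c → f x ≠ 0 := fun x hx h0 => hx (hc x h0)
  -- by the intermediate value theorem the sign is constant on either side of `c`
  have hconst : ∀ x y, (c < x ↔ c < y) → x ≠ c → y ≠ c → 0 < f x → 0 < f y := by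
    intro x y hxy hxc hyc hx
    by_contra hy
    obtain ⟨z, hz, hz0⟩ := intermediate_value_uIcc hf.continuousOn (a := y) (b := x)
      (show (0:ℝ) ∈ uIcc (f y) (f x) from mem_uIcc.2 (Or.inl ⟨not_lt.1 hy, hx.le⟩))
    obtain rfl := hc z hz0
    rcases mem_uIcc.1 hz with hz | hz <;> grind
  obtain ⟨x, y, hxy⟩ := hsign
  have hxc : x ≠ c := by rintro rfl; simp [hc0] at hxy
  have hyc : y ≠ c := by rintro rfl; simp [hc0] at hxy
  obtain ⟨u, v, hu, hv, huc, hvc⟩ : ∃ u v, 0 < f u ∧ f v < 0 ∧ u ≠ c ∧ v ≠ c := by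
    rcases mul_neg_iff.1 hxy with h | h
    · exact ⟨x, y, h.1, h.2, hxc, hyc⟩
    · exact ⟨y, x, h.2, h.1, hyc, hxc⟩
  refine ⟨c < u, fun z hz => ?_⟩
  constructor
  · intro hpos
    have h1 := hconst z v
    grind
  · intro hs
    exact hconst u z hs.symm huc hz hu

theorem IsSimpleArrangement.degreeCondition {L : Set (Set Plane)}
    (h : IsSimpleArrangement IsPseudoline L) {π : List ℕ}
    (hπ : IsDegreeSequence (arrangementGraph L) π) : DegreeCondition π := by
  obtain ⟨e, -⟩ := hπ.2
  have hfin : L.Finite := h.finite (Set.finite_coe_iff.1 (Finite.of_equiv _ e))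
  have : Finite L := hfin
  set n := Nat.card L with hn
  have h3 : 3 ≤ n := by
    have := h.three_le
    rw [hfin.encard_eq_coe_toFinset_card, ← Set.ncard_eq_toFinset_card L hfin,
      ← Nat.card_coe_set_eq] at this
    exact_mod_cast this
  let σ : Fin n ≃ L := (Finite.equivFin L).symm
  have hσ : ∀ {i j}, i ≠ j → (σ i : Set Plane) ≠ σ j := fun hij e => hij (σ.injective (Subtype.ext e))
  choose φ hφ hrange using fun i => exists_isEmbedding_of_isPseudoline (h.kind _ (σ i).2)
  choose F hF using fun i => exists_isSideFunction_of_isPseudoline (h.kind _ (σ i).2)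
  have hex : ∀ i j, ∃ a : ℝ, i ≠ j → φ i a ∈ (σ j : Set Plane) ∧
      ∀ b, φ i b ∈ (σ j : Set Plane) → b = a := by
    intro i j
    by_cases hij : i = j
    · exact ⟨0, fun h => absurd hij h⟩
    obtain ⟨p, hp⟩ := (h.cross _ (σ i).2 _ (σ j).2 (hσ hij)).1
    have hpm : p ∈ (σ i : Set Plane) ∩ σ j := hp ▸ rfl
    obtain ⟨a, rfl⟩ : p ∈ range (φ i) := hrange i ▸ hpm.1
    refine ⟨a, fun _ => ⟨hpm.2, fun b hb => (hφ i).injective ?_⟩⟩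
    have : φ i b ∈ (σ i : Set Plane) ∩ σ j := ⟨hrange i ▸ ⟨b, rfl⟩, hb⟩
    rwa [hp] at this
  choose t ht using hex
  have hmem : ∀ i a, φ i a ∈ (σ i : Set Plane) := fun i a => hrange i ▸ ⟨a, rfl⟩
  have hfam : IsCurveFamily φ t := by
    refine ⟨hφ, fun i j hij => ?_, fun i j hij a b hab => ?_, fun i j k hij hik hjk e => ?_⟩
    · obtain ⟨b, hb⟩ : φ i (t i j) ∈ range (φ j) := hrange j ▸ (ht i j hij).1
      rw [← hb, (ht j i hij.symm).2 b (hb ▸ hmem i _)]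
    · exact (ht i j hij).2 a (hab ▸ hmem j b)
    · have hp : φ i (t i j) ∈ (σ i : Set Plane) ∩ σ j ∩ σ k :=
        ⟨⟨hmem i _, (ht i j hij).1⟩, e ▸ (ht i k hik).1⟩
      rw [h.simple _ (σ i).2 _ (σ j).2 _ (σ k).2 (hσ hij) (hσ hik) (hσ hjk)] at hp
      exact hp
  have hside : ∀ i k, ∃ s : Prop, i ≠ k → ∀ x, x ≠ t i k → (0 < F k (φ i x) ↔ (t i k < x ↔ s)) := by
    intro i k
    by_cases hik : i = k
    · exact ⟨True, fun h => absurd hik h⟩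
    obtain ⟨x, hx, y, hy, hxy⟩ := (h.cross _ (σ k).2 _ (σ i).2 (hσ (Ne.symm hik))).2.1
    replace hxy := (hF k).mul_neg_of_separates hxy
    obtain ⟨x, rfl⟩ : x ∈ range (φ i) := hrange i ▸ hx
    obtain ⟨y, rfl⟩ : y ∈ range (φ i) := hrange i ▸ hy
    obtain ⟨s, hs⟩ := exists_side_iff (f := F k ∘ φ i) ((hF k).continuous.comp (hφ i).continuous)
      (c := t i k) (fun z hz => (ht i k hik).2 z (((hF k).eq_zero_iff _).1 hz)) ⟨x, y, hxy⟩
      (((hF k).eq_zero_iff _).2 (ht i k hik).1)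
    exact ⟨s, fun _ => hs⟩
  choose g hg using hside
  have hsided : IsSidedCrossing t g := by
    refine ⟨hfam.distinct, fun i j k hij hik hjk => ?_⟩
    rw [← hg i k hik _ (hfam.distinct i j k hij hik hjk),
      ← hg j k hjk _ (hfam.distinct j i k hij.symm hjk hik), hfam.meet i j hij]
  have hL : (range fun i => range (φ i)) = L := by
    ext l
    constructor
    · rintro ⟨i, rfl⟩
      change range (φ i) ∈ L
      rw [hrange]
      exact (σ i).2
    · intro hl
      exact ⟨σ.symm ⟨l, hl⟩, by simp [hrange]⟩
  rw [← hL] at hπ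
  exact hfam.degreeCondition hsided h3 hπ

/-! ### Arrangements of nonvertical lines -/

/-- The line `y = m x + c`, parametrized by the abscissa. -/
noncomputable def graphLine (m c : ℝ) (x : ℝ) : Plane := !₂[x, m * x + c]

@[simp] theorem graphLine_zero (m c x : ℝ) : graphLine m c x 0 = x := by simp [graphLine]

@[simp] theorem graphLine_one (m c x : ℝ) : graphLine m c x 1 = m * x + c := by simp [graphLine]

theorem isEmbedding_graphLine (m c : ℝ) : IsEmbedding (graphLine m c) := by
  refine Function.LeftInverse.isEmbedding (f := fun x : Plane => x 0) (fun x => by simp)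
    (by fun_prop) ?_
  unfold graphLine
  fun_prop

theorem mem_range_graphLine {m c : ℝ} {x : Plane} :
    x ∈ range (graphLine m c) ↔ x 1 = m * x 0 + c := by
  constructor
  · rintro ⟨s, rfl⟩
    simp
  · intro h
    refine ⟨x 0, PiLp.ext fun i => ?_⟩
    fin_cases i <;> simp [h]

theorem isLine_range_graphLine (m c : ℝ) : IsLine (range (graphLine m c)) := by
  refine ⟨graphLine m c 0, graphLine m c 1,
    (isEmbedding_graphLine m c).injective.ne zero_ne_one, ?_⟩
  ext x
  rw [SetLike.mem_coe, mem_affineSpan_pair_iff_exists_lineMap_eq]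
  refine exists_congr fun s => ?_
  have : AffineMap.lineMap (graphLine m c 0) (graphLine m c 1) s = graphLine m c s := by
    refine PiLp.ext fun i => ?_
    fin_cases i
    · simp [AffineMap.lineMap_apply]
    · simp [AffineMap.lineMap_apply]
      ring
  rw [this]

/-- The abscissa of the crossing of `y = m i x + c i` with `y = m j x + c j`. -/
noncomputable def crossingAbscissa {n : ℕ} (m c : Fin n → ℝ) (i j : Fin n) : ℝ :=
  (c j - c i) / (m i - m j)

section

variable {n : ℕ} {m c : Fin n → ℝ}

theorem crossingAbscissa_comm (i j : Fin n) :
    crossingAbscissa m c i j = crossingAbscissa m c j i := by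
  rw [crossingAbscissa, crossingAbscissa, ← neg_sub (c i), ← neg_sub (m j), neg_div_neg_eq]

theorem isCurveFamily_graphLine (hm : Function.Injective m)
    (hd : CrossingsDistinct (crossingAbscissa m c)) :
    IsCurveFamily (fun i => graphLine (m i) (c i)) (crossingAbscissa m c) where
  isEmbedding i := isEmbedding_graphLine _ _
  meet i j hij := by
    have : m i - m j ≠ 0 := sub_ne_zero.2 (hm.ne hij)
    have key : (m i - m j) * crossingAbscissa m c i j = c j - c i := mul_div_cancel₀ _ this
    rw [← crossingAbscissa_comm i j]
    refine PiLp.ext fun k => ?_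
    fin_cases k
    · simp
    · simp
      linarith
  eq_of_meet i j hij a b hab := by
    have : m i - m j ≠ 0 := sub_ne_zero.2 (hm.ne hij)
    have h0 := congrArg (fun x : Plane => x 0) hab
    have h1 := congrArg (fun x : Plane => x 1) hab
    simp only [graphLine_zero, graphLine_one] at h0 h1
    subst h0
    rw [crossingAbscissa, eq_div_iff this]
    linarith
  distinct := hd

theorem isSimpleArrangement_graphLine (hn : 3 ≤ n) (hm : Function.Injective m)
    (hd : CrossingsDistinct (crossingAbscissa m c)) :
    IsSimpleArrangement IsLine (range fun i => range (graphLine (m i) (c i))) := by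
  have hfam := isCurveFamily_graphLine hm hd
  have hside : ∀ i j, i ≠ j →
      ChangesSide (range (graphLine (m i) (c i))) (range (graphLine (m j) (c j))) := by
    intro i j hij
    have : m i - m j ≠ 0 := sub_ne_zero.2 (hm.ne hij)
    have key : (m i - m j) * crossingAbscissa m c i j = c j - c i := mul_div_cancel₀ _ this
    refine ⟨_, ⟨crossingAbscissa m c i j + 1, rfl⟩, _, ⟨crossingAbscissa m c i j - 1, rfl⟩, ?_⟩
    refine separates_of_mul_neg (F := fun x => x 1 - (m i * x 0 + c i)) (by fun_prop)
      (fun x => by rw [mem_range_graphLine, sub_eq_zero]) ?_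
    simp only [graphLine_zero, graphLine_one]
    have e1 : m j * (crossingAbscissa m c i j + 1) + c j -
      (m i * (crossingAbscissa m c i j + 1) + c i) = - (m i - m j) := by linarith
    have e2 : m j * (crossingAbscissa m c i j - 1) + c j -
      (m i * (crossingAbscissa m c i j - 1) + c i) = m i - m j := by linarith
    rw [e1, e2, neg_mul, neg_lt_zero]
    exact mul_self_pos.2 this
  refine ⟨?_, ?_, ?_, ?_⟩
  · rw [← image_univ, hfam.range_injective.encard_image, encard_univ, ENat.card_eq_coe_fintype_card,
      Fintype.card_fin]
    exact_mod_cast hn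
  · rintro _ ⟨i, rfl⟩
    exact isLine_range_graphLine _ _
  · rintro _ ⟨i, rfl⟩ _ ⟨j, rfl⟩ hne
    have hij : i ≠ j := fun e => hne (by rw [e])
    refine ⟨⟨graphLine (m i) (c i) (crossingAbscissa m c i j), ?_⟩, hside i j hij,
      hside j i hij.symm⟩
    refine Set.eq_singleton_iff_unique_mem.2 ⟨⟨⟨_, rfl⟩, ⟨_, (hfam.meet i j hij).symm⟩⟩, ?_⟩
    rintro _ ⟨⟨a, rfl⟩, ⟨b, hb⟩⟩
    exact congrArg _ (hfam.eq_of_meet i j hij a b hb.symm)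
  · rintro _ ⟨i, rfl⟩ _ ⟨j, rfl⟩ _ ⟨k, rfl⟩ hij hik hjk
    have hij : i ≠ j := fun e => hij (by rw [e])
    have hik : i ≠ k := fun e => hik (by rw [e])
    have hjk : j ≠ k := fun e => hjk (by rw [e])
    rw [Set.eq_empty_iff_forall_notMem]
    rintro _ ⟨⟨⟨a, rfl⟩, ⟨b, hb⟩⟩, ⟨b', hb'⟩⟩
    exact hd i j k hij hik hjk ((hfam.eq_of_meet i j hij a b hb.symm).symm.trans
      (hfam.eq_of_meet i k hik a b' hb'.symm))

end

/-- `n` nonvertical lines in general position can be chosen such that their arrangement has exactly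
`d` vertices of degree two. -/
def ExistsLines (n d : ℕ) : Prop :=
  ∃ m c : Fin n → ℝ, Function.Injective m ∧ CrossingsDistinct (crossingAbscissa m c) ∧
    degreeCount (crossingAbscissa m c) 2 = d

/-! ### Tangents of a hyperbola -/

theorem crossingAbscissa_hyperbola {n : ℕ} (v : Fin n → ℝ) {i j : Fin n} (h : v i ≠ v j)
    (h' : v i + v j ≠ 0) :
    crossingAbscissa (fun i => - v i ^ 2) (fun i => 2 * v i) i j = 2 / (v i + v j) := by
  have h1 : v j - v i ≠ 0 := sub_ne_zero.2 h.symm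
  have h2 : - v i ^ 2 - - v j ^ 2 = (v j - v i) * (v i + v j) := by ring
  rw [crossingAbscissa, h2, div_eq_div_iff (mul_ne_zero h1 h') h']
  ring

theorem two_div_lt_two_div_iff {a b : ℤ} (ha : a ≠ 0) (hb : b ≠ 0) :
    (2 : ℝ) / a < 2 / b ↔ (a < 0 ∧ 0 < b) ∨ (b < a ∧ (0 < b ∨ a < 0)) := by
  have key : ∀ {a b : ℝ}, 0 < b → b < a → 2 / a < 2 / b := fun hb hab =>
    div_lt_div_of_pos_left two_pos hb hab
  have key' : ∀ {a b : ℝ}, a < 0 → b < a → 2 / a < 2 / b := fun {a b} ha hab => by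
    have := key (a := -b) (b := -a) (by linarith) (by linarith)
    rw [div_neg, div_neg] at this
    linarith
  have mixed : ∀ {a b : ℝ}, a < 0 → 0 < b → 2 / a < 2 / b := fun ha hb =>
    (div_neg_of_pos_of_neg two_pos ha).trans (div_pos two_pos hb)
  constructor
  · intro h
    by_contra hcon
    rcases lt_trichotomy a b with hab | rfl | hab
    · have : (2 : ℝ) / b < 2 / a := by
        rcases lt_or_gt_of_ne hb with hb' | hb'
        · exact key' (by exact_mod_cast hb') (by exact_mod_cast hab)
        · have : 0 < a := by omega
          exact key (by exact_mod_cast this) (by exact_mod_cast hab)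
      exact lt_asymm h this
    · exact lt_irrefl _ h
    · have h1 : b < 0 := by omega
      have h2 : 0 < a := by omega
      exact lt_asymm h (mixed (by exact_mod_cast h1) (by exact_mod_cast h2))
  · rintro (⟨h1, h2⟩ | ⟨h1, h2 | h2⟩)
    · exact mixed (by exact_mod_cast h1) (by exact_mod_cast h2)
    · exact key (by exact_mod_cast h2) (by exact_mod_cast h1)
    · exact key' (by exact_mod_cast h2) (by exact_mod_cast h1)

/-- The numbers `±1, ∓2, …, -(d - 1), d, d + 1, d + 2, …`: alternating signs up to the index
`d - 1`, positive from there on (truncated subtraction makes the exponent zero). -/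
def alternatingThenPositive (d i : ℕ) : ℤ := (-1) ^ (d - 1 - i) * (i + 1)

theorem alternatingThenPositive_cases (d i : ℕ) :
    alternatingThenPositive d i = i + 1 ∨ alternatingThenPositive d i = -(i + 1) := by
  unfold alternatingThenPositive
  rcases neg_one_pow_eq_or ℤ (d - 1 - i) with h | h <;> simp [h]

theorem alternatingThenPositive_of_le {d i : ℕ} (h : d ≤ i + 1) :
    alternatingThenPositive d i = i + 1 := by
  have : d - 1 - i = 0 := by omega
  simp [alternatingThenPositive, this]

theorem alternatingThenPositive_succ {d i : ℕ} (h : i + 1 < d) :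
    (alternatingThenPositive d i = i + 1 ∧ alternatingThenPositive d (i + 1) = -(i + 2)) ∨
    (alternatingThenPositive d i = -(i + 1) ∧ alternatingThenPositive d (i + 1) = i + 2) := by
  have e : d - 1 - i = (d - 1 - (i + 1)) + 1 := by omega
  unfold alternatingThenPositive
  rw [e, pow_succ]
  rcases neg_one_pow_eq_or ℤ (d - 1 - (i + 1)) with h | h
  · right
    constructor
    · rw [h]; ring
    · rw [h]; push_cast; ring
  · left
    constructor
    · rw [h]; ring
    · rw [h]; push_cast; ring

section

variable {n d : ℕ}

/-- The abscissas of the crossings of the tangents `y = -v² x + 2 v` of a hyperbola, for the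
parameters `v` given by `alternatingThenPositive`. -/
noncomputable def hyperbolaAbscissa (n d : ℕ) : Fin n → Fin n → ℝ :=
  crossingAbscissa (fun i => - ((alternatingThenPositive d i : ℤ) : ℝ) ^ 2)
    (fun i => 2 * ((alternatingThenPositive d i : ℤ) : ℝ))

theorem alternatingThenPositive_add_ne_zero {i j : ℕ} (h : i ≠ j) :
    alternatingThenPositive d i + alternatingThenPositive d j ≠ 0 := by
  have := alternatingThenPositive_cases d i
  have := alternatingThenPositive_cases d j
  omega

theorem alternatingThenPositive_ne {i j : ℕ} (h : i ≠ j) :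
    alternatingThenPositive d i ≠ alternatingThenPositive d j := by
  have := alternatingThenPositive_cases d i
  have := alternatingThenPositive_cases d j
  omega

theorem hyperbolaAbscissa_eq {i j : Fin n} (h : i ≠ j) : hyperbolaAbscissa n d i j =
    2 / ((alternatingThenPositive d i + alternatingThenPositive d j : ℤ) : ℝ) := by
  have h' : (i : ℕ) ≠ j := fun e => h (Fin.ext e)
  have h1 := alternatingThenPositive_ne (d := d) h'
  have h2 := alternatingThenPositive_add_ne_zero (d := d) h'
  have := crossingAbscissa_hyperbola (fun i : Fin n => ((alternatingThenPositive d i : ℤ) : ℝ))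
    (i := i) (j := j) (by exact_mod_cast h1) (by exact_mod_cast h2)
  rw [hyperbolaAbscissa, this]
  push_cast
  rfl

theorem hyperbolaAbscissa_lt_iff {i j k : Fin n} (hij : i ≠ j) (hik : i ≠ k) :
    hyperbolaAbscissa n d i j < hyperbolaAbscissa n d i k ↔
      (alternatingThenPositive d i + alternatingThenPositive d j < 0 ∧
        0 < alternatingThenPositive d i + alternatingThenPositive d k) ∨
      (alternatingThenPositive d k < alternatingThenPositive d j ∧
        (0 < alternatingThenPositive d i + alternatingThenPositive d k ∨
          alternatingThenPositive d i + alternatingThenPositive d j < 0)) := by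
  rw [hyperbolaAbscissa_eq hij, hyperbolaAbscissa_eq hik,
    two_div_lt_two_div_iff (alternatingThenPositive_add_ne_zero fun e => hij (Fin.ext e))
      (alternatingThenPositive_add_ne_zero fun e => hik (Fin.ext e)), add_lt_add_iff_left]

theorem crossingsDistinct_hyperbola : CrossingsDistinct (hyperbolaAbscissa n d) := by
  intro i j k hij hik hjk
  have h := alternatingThenPositive_ne (d := d) (fun e => hjk (Fin.ext e))
  have h1 := alternatingThenPositive_add_ne_zero (d := d) (fun e => hij (Fin.ext e))
  have h2 := alternatingThenPositive_add_ne_zero (d := d) (fun e => hik (Fin.ext e))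
  have := hyperbolaAbscissa_lt_iff (d := d) hij hik
  have := hyperbolaAbscissa_lt_iff (d := d) hik hij
  rcases lt_or_gt_of_ne h with h | h <;> grind

/-- The vertices of degree two are the crossings of consecutive lines in the alternating part and
the crossing of the last two lines. -/
theorem isExtreme_hyperbola_iff (hd : 3 ≤ d) (hdn : d < n) {i j : Fin n} (hij : i < j) :
    (IsExtreme (hyperbolaAbscissa n d) i j ∧ IsExtreme (hyperbolaAbscissa n d) j i) ↔
      (j : ℕ) = i + 1 ∧ ((j : ℕ) < d ∨ (j : ℕ) + 1 = n) := by
  have hb : ∀ {i j : Fin n}, i ≠ j → ∀ k : ℕ, k < n → k ≠ i → k ≠ j →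
      ((alternatingThenPositive d i + alternatingThenPositive d k < 0 ∧
        0 < alternatingThenPositive d i + alternatingThenPositive d j) ∨
      (alternatingThenPositive d j < alternatingThenPositive d k ∧
        (0 < alternatingThenPositive d i + alternatingThenPositive d j ∨
          alternatingThenPositive d i + alternatingThenPositive d k < 0))) →
      HasBefore (hyperbolaAbscissa n d) i j := by
    intro i j hij k hk hki hkj h
    exact ⟨⟨k, hk⟩, fun e => hki (congrArg Fin.val e), fun e => hkj (congrArg Fin.val e),
      (hyperbolaAbscissa_lt_iff (fun e => hki (congrArg Fin.val e).symm) hij).2 h⟩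
  have ha : ∀ {i j : Fin n}, i ≠ j → ∀ k : ℕ, k < n → k ≠ i → k ≠ j →
      ((alternatingThenPositive d i + alternatingThenPositive d j < 0 ∧
        0 < alternatingThenPositive d i + alternatingThenPositive d k) ∨
      (alternatingThenPositive d k < alternatingThenPositive d j ∧
        (0 < alternatingThenPositive d i + alternatingThenPositive d k ∨
          alternatingThenPositive d i + alternatingThenPositive d j < 0))) →
      HasAfter (hyperbolaAbscissa n d) i j := by
    intro i j hij k hk hki hkj h
    exact ⟨⟨k, hk⟩, fun e => hki (congrArg Fin.val e), fun e => hkj (congrArg Fin.val e),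
      (hyperbolaAbscissa_lt_iff hij (fun e => hki (congrArg Fin.val e).symm)).2 h⟩
  have hlt : (i : ℕ) < j := hij
  have hjn := j.2
  have ci := alternatingThenPositive_cases d i
  have cj := alternatingThenPositive_cases d j
  have ti := alternatingThenPositive_of_le (d := d) (i := i)
  have tj := alternatingThenPositive_of_le (d := d) (i := j)
  obtain ⟨e, rfl⟩ : ∃ e, d = e + 3 := ⟨d - 3, by omega⟩
  have s0 := alternatingThenPositive_succ (d := e + 3) (i := e) (by omega)
  have s1 := alternatingThenPositive_succ (d := e + 3) (i := e + 1) (by omega)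
  have s2 := alternatingThenPositive_of_le (d := e + 3) (i := e + 2) (by omega)
  push_cast at s0 s1 s2
  simp only [add_assoc, Nat.reduceAdd] at s0 s1 s2
  constructor
  · rintro ⟨h1, h2⟩
    by_contra hcon
    by_cases hjd : e + 3 ≤ j
    · by_cases hid : (i : ℕ) = e + 1
      · -- the neighbours of `i` in the alternating part give the sums `1` and `-1`
        have hi : alternatingThenPositive (e + 3) i = alternatingThenPositive (e + 3) (e + 1) := by
          rw [hid]
        have B := hb hij.ne e (by omega) (by omega) (by omega) (by omega)
        have A := ha hij.ne (e + 2) (by omega) (by omega) (by omega) (by omega)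
        exact h1.elim (· B) (· A)
      · -- on line `j` the sums are positive, the least one occurring at the last negative number
        have A := ha hij.ne' (e + 1) (by omega) (by omega) (by omega) (by omega)
        have t1 := alternatingThenPositive_of_le (d := e + 3) (i := n - 1) (by omega)
        have t2 := alternatingThenPositive_of_le (d := e + 3) (i := n - 2) (by omega)
        by_cases hj : (j : ℕ) + 1 = n
        · have B := hb hij.ne' (n - 2) (by omega) (by omega) (by omega) (by omega)
          exact h2.elim (· B) (· A)
        · have B := hb hij.ne' (n - 1) (by omega) (by omega) (by omega) (by omega)
          exact h2.elim (· B) (· A)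
    · by_cases hi0 : (i : ℕ) = 0
      · obtain ⟨k, hk⟩ : ∃ k, (j : ℕ) = k + 1 := ⟨j - 1, by omega⟩
        have u1 := alternatingThenPositive_succ (d := e + 3) (i := k) (by omega)
        rw [← hk] at u1
        by_cases hje : (j : ℕ) = e + 2
        · have u2 := alternatingThenPositive_of_le (d := e + 3) (i := e + 3) (by omega)
          have B := hb hij.ne' (e + 3) (by omega) (by omega) (by omega) (by omega)
          have A := ha hij.ne' k (by omega) (by omega) (by omega) (by omega)
          exact h2.elim (· B) (· A)
        · have u2 := alternatingThenPositive_succ (d := e + 3) (i := j) (by omega)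
          rcases u2 with u2 | u2
          · have B := hb hij.ne' (j + 1) (by omega) (by omega) (by omega) (by omega)
            have A := ha hij.ne' k (by omega) (by omega) (by omega) (by omega)
            exact h2.elim (· B) (· A)
          · have B := hb hij.ne' k (by omega) (by omega) (by omega) (by omega)
            have A := ha hij.ne' (j + 1) (by omega) (by omega) (by omega) (by omega)
            exact h2.elim (· B) (· A)
      · obtain ⟨k, hk⟩ : ∃ k, (i : ℕ) = k + 1 := ⟨i - 1, by omega⟩
        have u1 := alternatingThenPositive_succ (d := e + 3) (i := k) (by omega)
        rw [← hk] at u1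
        have u2 := alternatingThenPositive_succ (d := e + 3) (i := i) (by omega)
        rcases u2 with u2 | u2
        · have B := hb hij.ne (i + 1) (by omega) (by omega) (by omega) (by omega)
          have A := ha hij.ne k (by omega) (by omega) (by omega) (by omega)
          exact h1.elim (· B) (· A)
        · have B := hb hij.ne k (by omega) (by omega) (by omega) (by omega)
          have A := ha hij.ne (i + 1) (by omega) (by omega) (by omega) (by omega)
          exact h1.elim (· B) (· A)
  · rintro ⟨hj, hj'⟩
    by_cases hjd : (j : ℕ) < e + 3
    · have u := alternatingThenPositive_succ (d := e + 3) (i := i) (by omega)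
      rw [← hj] at u
      rcases u with u | u
      · refine ⟨Or.inl ?_, Or.inl ?_⟩
        · rintro ⟨k, hki, hkj, hk⟩
          rw [hyperbolaAbscissa_lt_iff hki.symm hij.ne] at hk
          omega
        · rintro ⟨k, hki, hkj, hk⟩
          rw [hyperbolaAbscissa_lt_iff hki.symm hij.ne'] at hk
          omega
      · refine ⟨Or.inr ?_, Or.inr ?_⟩
        · rintro ⟨k, hki, hkj, hk⟩
          rw [hyperbolaAbscissa_lt_iff hij.ne hki.symm] at hk
          omega
        · rintro ⟨k, hki, hkj, hk⟩
          rw [hyperbolaAbscissa_lt_iff hij.ne' hki.symm] at hk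
          omega
    · have vi := ti (by omega)
      have vj := tj (by omega)
      refine ⟨Or.inl ?_, Or.inl ?_⟩
      · rintro ⟨k, hki, hkj, hk⟩
        rw [hyperbolaAbscissa_lt_iff hki.symm hij.ne] at hk
        have ck := alternatingThenPositive_cases (e + 3) k
        have := k.2
        have : (k : ℕ) ≠ i := fun h => hki (Fin.ext h)
        have : (k : ℕ) ≠ j := fun h => hkj (Fin.ext h)
        omega
      · rintro ⟨k, hki, hkj, hk⟩
        rw [hyperbolaAbscissa_lt_iff hki.symm hij.ne'] at hk
        have ck := alternatingThenPositive_cases (e + 3) k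
        have := k.2
        have : (k : ℕ) ≠ i := fun h => hkj (Fin.ext h)
        have : (k : ℕ) ≠ j := fun h => hki (Fin.ext h)
        omega

theorem existsLines_of_lt (hd : 3 ≤ d) (hdn : d < n) : ExistsLines n d := by
  refine ⟨_, _, ?_, crossingsDistinct_hyperbola (n := n) (d := d), ?_⟩
  · intro i j h
    by_contra hne
    have h' : (i : ℕ) ≠ j := fun e => hne (Fin.ext e)
    have h1 := alternatingThenPositive_ne (d := d) h'
    have h2 := alternatingThenPositive_add_ne_zero (d := d) h'
    rcases sq_eq_sq_iff_eq_or_eq_neg.1 (neg_injective h) with h | h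
    · exact h1 (by exact_mod_cast h)
    · exact h2 (by rw [← eq_neg_iff_add_eq_zero]; exact_mod_cast h)
  · change degreeCount (hyperbolaAbscissa n d) 2 = d
    have hfilter : (crossingPairs n).filter (fun p => crossingDegree (hyperbolaAbscissa n d) p.1 p.2 = 2)
        = (crossingPairs n).filter
          (fun p => (p.2 : ℕ) = p.1 + 1 ∧ ((p.2 : ℕ) < d ∨ (p.2 : ℕ) + 1 = n)) := by
      refine Finset.filter_congr fun p hp => ?_
      rw [crossingDegree_eq_two_iff crossingsDistinct_hyperbola (by omega)
        (ne_of_mem_crossingPairs hp), isExtreme_hyperbola_iff hd hdn (Finset.mem_filter.1 hp).2]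
    rw [degreeCount, hfilter]
    have himage : ((crossingPairs n).filter (fun p => (p.2 : ℕ) = p.1 + 1 ∧
        ((p.2 : ℕ) < d ∨ (p.2 : ℕ) + 1 = n))).image (fun p => (p.1 : ℕ)) =
        insert (n - 2) (Finset.range (d - 1)) := by
      ext k
      simp only [crossingPairs, Finset.mem_image, Finset.mem_filter, Finset.mem_univ, true_and,
        Finset.mem_insert, Finset.mem_range]
      constructor
      · rintro ⟨⟨i, j⟩, ⟨-, h1, h2⟩, rfl⟩
        simp only at h1 h2 ⊢
        omega
      · intro hk
        refine ⟨(⟨k, by omega⟩, ⟨k + 1, by omega⟩), ⟨?_, rfl, ?_⟩, rfl⟩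
        · exact Fin.mk_lt_mk.2 (Nat.lt_succ_self k)
        · simp only
          omega
    rw [← Finset.card_image_of_injOn (f := fun p : Fin n × Fin n => (p.1 : ℕ)), himage,
      Finset.card_insert_of_notMem, Finset.card_range]
    · omega
    · simp only [Finset.mem_range]
      omega
    · rintro ⟨i, j⟩ hp ⟨i', j'⟩ hp' e
      simp only [Finset.coe_filter, mem_ofPred_eq] at hp hp' e
      have h1 : i = i' := Fin.ext e
      have h2 : j = j' := Fin.ext (by omega)
      rw [h1, h2]

end

/-! ### The sides of a regular polygon -/

/-- The crossing of two tangents `y cos a - x sin a = 1` of the unit circle, in terms of half the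
angle `δ` between them. -/
theorem crossingAbscissa_circle {n : ℕ} (a : Fin n → ℝ) {i j : Fin n} {δ : ℝ}
    (hδ : a j = a i + 2 * δ) (hi : Real.cos (a i) ≠ 0) (hj : Real.cos (a j) ≠ 0)
    (hs : Real.sin δ ≠ 0) (hc : Real.cos δ ≠ 0) :
    crossingAbscissa (fun i => Real.tan (a i)) (fun i => 1 / Real.cos (a i)) i j =
      - Real.sin (a i) - Real.cos (a i) * Real.tan δ := by
  have h1 : Real.tan (a i) - Real.tan (a j) =
      - (2 * Real.sin δ * Real.cos δ) / (Real.cos (a i) * Real.cos (a j)) := by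
    rw [Real.tan_eq_sin_div_cos, Real.tan_eq_sin_div_cos, div_sub_div _ _ hi hj]
    congr 1
    rw [← Real.sin_two_mul, show 2 * δ = a j - a i by linarith, Real.sin_sub]
    ring
  have h2 : 1 / Real.cos (a j) - 1 / Real.cos (a i) =
      (2 * Real.sin δ * (Real.cos (a i) * Real.sin δ + Real.sin (a i) * Real.cos δ)) /
        (Real.cos (a i) * Real.cos (a j)) := by
    rw [div_sub_div _ _ hj hi, mul_comm (Real.cos (a j)) (Real.cos (a i))]
    congr 1
    rw [hδ, Real.cos_add, Real.sin_two_mul, Real.cos_two_mul, Real.cos_sq']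
    ring
  rw [crossingAbscissa, h1, h2, div_div_div_cancel_right₀ (mul_ne_zero hi hj),
    Real.tan_eq_sin_div_cos]
  field_simp
  ring

section

variable {K : ℕ}

/-- The direction of the `i`-th side of a regular polygon with `2 K + 1` sides; as the number of
sides is odd, no side is vertical. -/
noncomputable def polygonAngle (K : ℕ) (i : Fin (2 * K + 1)) : ℝ :=
  2 * (Real.pi * (i : ℕ) / (2 * K + 1))

/-- The abscissas of the crossings of the sides of a regular polygon with `2 K + 1` sides. -/
noncomputable def polygonAbscissa (K : ℕ) : Fin (2 * K + 1) → Fin (2 * K + 1) → ℝ :=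
  crossingAbscissa (fun i => Real.tan (polygonAngle K i)) (fun i => 1 / Real.cos (polygonAngle K i))

theorem cos_pi_mul_div_ne_zero (K : ℕ) (D : ℤ) : Real.cos (Real.pi * D / (2 * K + 1)) ≠ 0 := by
  rw [Real.cos_ne_zero_iff]
  intro k hk
  have hK : (2 * K + 1 : ℝ) ≠ 0 := by positivity
  rw [div_eq_div_iff hK two_ne_zero] at hk
  have : (D : ℝ) * 2 = (2 * k + 1) * (2 * K + 1) := by
    refine mul_left_cancel₀ Real.pi_ne_zero ?_
    linarith
  have h : D * 2 = (2 * k + 1) * (2 * K + 1) := by exact_mod_cast this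
  have h' : (2 * k + 1) * (2 * (K : ℤ) + 1) = 2 * (2 * k * K + k + K) + 1 := by ring
  omega

theorem sin_pi_mul_div_ne_zero {K : ℕ} {D : ℤ} (h0 : D ≠ 0) (hD : |D| < 2 * K + 1) :
    Real.sin (Real.pi * D / (2 * K + 1)) ≠ 0 := by
  rw [Real.sin_ne_zero_iff]
  intro k hk
  have hK : (2 * K + 1 : ℝ) ≠ 0 := by positivity
  rw [eq_div_iff hK] at hk
  have : (k : ℝ) * (2 * K + 1) = D := by
    refine mul_left_cancel₀ Real.pi_ne_zero ?_
    linarith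
  have h : k * (2 * K + 1) = D := by exact_mod_cast this
  exact h0 (Int.eq_zero_of_abs_lt_dvd (m := 2 * K + 1) ⟨k, by rw [← h]; ring⟩ hD)

theorem abs_sub_lt {n : ℕ} (i j : Fin n) : |((j : ℕ) : ℤ) - ((i : ℕ) : ℤ)| < n := by
  rw [abs_lt]
  omega

theorem fin_sub_ne_zero {n : ℕ} {i j : Fin n} (h : i ≠ j) : ((j : ℕ) : ℤ) - ((i : ℕ) : ℤ) ≠ 0 := by
  omega

theorem cos_polygonAngle_ne_zero (i : Fin (2 * K + 1)) : Real.cos (polygonAngle K i) ≠ 0 := by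
  have := cos_pi_mul_div_ne_zero K (2 * (i : ℕ))
  convert this using 2
  rw [polygonAngle]
  push_cast
  ring

theorem polygonAbscissa_eq {i j : Fin (2 * K + 1)} (hij : i ≠ j) :
    polygonAbscissa K i j = - Real.sin (polygonAngle K i) - Real.cos (polygonAngle K i) *
      Real.tan (Real.pi * (((j : ℕ) : ℤ) - ((i : ℕ) : ℤ) : ℤ) / (2 * K + 1)) := by
  refine crossingAbscissa_circle _ ?_ (cos_polygonAngle_ne_zero i) (cos_polygonAngle_ne_zero j)
    (sin_pi_mul_div_ne_zero (fin_sub_ne_zero hij) (by exact_mod_cast abs_sub_lt i j))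
    (cos_pi_mul_div_ne_zero K _)
  rw [polygonAngle, polygonAngle]
  push_cast
  ring

theorem tan_ne_tan_of_sin_sub_ne_zero {x y : ℝ} (hx : Real.cos x ≠ 0) (hy : Real.cos y ≠ 0)
    (h : Real.sin (x - y) ≠ 0) : Real.tan x ≠ Real.tan y := by
  intro e
  rw [Real.tan_eq_sin_div_cos, Real.tan_eq_sin_div_cos, div_eq_div_iff hx hy] at e
  rw [Real.sin_sub] at h
  exact h (by linarith)

theorem crossingsDistinct_polygon : CrossingsDistinct (polygonAbscissa K) := by
  intro i j k hij hik hjk e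
  rw [polygonAbscissa_eq hij, polygonAbscissa_eq hik, sub_right_inj,
    mul_right_inj' (cos_polygonAngle_ne_zero i)] at e
  refine tan_ne_tan_of_sin_sub_ne_zero (cos_pi_mul_div_ne_zero K _) (cos_pi_mul_div_ne_zero K _) ?_ e
  have := sin_pi_mul_div_ne_zero (K := K) (fin_sub_ne_zero hjk.symm)
    (by exact_mod_cast abs_sub_lt k j)
  convert this using 2
  push_cast
  ring

/-- Among the values `tan (π D / (2K + 1))`, the largest is the one at `D = K`. -/
theorem tan_pi_mul_div_le {D : ℤ} (hD : |D| < 2 * K + 1) :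
    Real.tan (Real.pi * D / (2 * K + 1)) ≤ Real.tan (Real.pi * K / (2 * K + 1)) := by
  have hK : (0 : ℝ) < 2 * K + 1 := by positivity
  -- reduce `D` modulo `2K + 1` to the interval from `-K` to `K`
  obtain ⟨D', h1, h2, h3⟩ : ∃ D' : ℤ, -K ≤ D' ∧ D' ≤ K ∧
      Real.tan (Real.pi * D / (2 * K + 1)) = Real.tan (Real.pi * D' / (2 * K + 1)) := by
    have hadd : ∀ E : ℤ, Real.tan (Real.pi * (E + (2 * K + 1) : ℤ) / (2 * K + 1)) =
        Real.tan (Real.pi * E / (2 * K + 1)) := by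
      intro E
      rw [← Real.tan_add_pi (Real.pi * E / (2 * K + 1))]
      congr 1
      field_simp
      push_cast
      ring
    rw [abs_lt] at hD
    by_cases ha : K < D
    · refine ⟨D - (2 * K + 1), by omega, by omega, ?_⟩
      rw [← hadd (D - _), sub_add_cancel]
    by_cases hb : D < -K
    · exact ⟨D + (2 * K + 1), by omega, by omega, (hadd D).symm⟩
    · exact ⟨D, by omega, by omega, rfl⟩
  rw [h3]
  have hmem : ∀ E : ℤ, -K ≤ E → E ≤ K → Real.pi * E / (2 * K + 1) ∈
      Ioo (-(Real.pi / 2)) (Real.pi / 2) := by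
    intro E hE hE'
    have e1 : -(K : ℝ) ≤ E := by exact_mod_cast hE
    have e2 : (E : ℝ) ≤ K := by exact_mod_cast hE'
    constructor
    · rw [lt_div_iff₀ hK]
      nlinarith [Real.pi_pos]
    · rw [div_lt_iff₀ hK]
      nlinarith [Real.pi_pos]
  refine Real.strictMonoOn_tan.monotoneOn (hmem D' h1 h2) (by simpa using hmem K (by omega) le_rfl) ?_
  have : (D' : ℝ) ≤ K := by exact_mod_cast h2
  have := Real.pi_pos
  gcongr

/-- On every side of the polygon, the crossings with the two sides that are nearest to being
parallel to it are extreme. -/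
theorem isExtreme_polygon {i j : Fin (2 * K + 1)} (hij : i ≠ j)
    (h : ((j : ℕ) : ℤ) - ((i : ℕ) : ℤ) = K ∨ ((j : ℕ) : ℤ) - ((i : ℕ) : ℤ) = - K ∨
      ((j : ℕ) : ℤ) - ((i : ℕ) : ℤ) = K + 1 ∨ ((j : ℕ) : ℤ) - ((i : ℕ) : ℤ) = - (K + 1)) :
    IsExtreme (polygonAbscissa K) i j := by
  set c := Real.cos (polygonAngle K i) with hc
  set τ : ℤ → ℝ := fun D => Real.tan (Real.pi * D / (2 * K + 1)) with hτ
  have hneg : ∀ D, τ (-D) = - τ D := by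
    intro D
    simp only [hτ]
    rw [← Real.tan_neg]
    congr 1
    push_cast
    ring
  have hper : τ (K + 1) = - τ K := by
    rw [← hneg]
    simp only [hτ]
    rw [← Real.tan_add_pi (Real.pi * (-K : ℤ) / (2 * K + 1))]
    congr 1
    field_simp
    push_cast
    ring
  have hle : ∀ k, τ (((k : Fin (2 * K + 1)) : ℕ) - ((i : ℕ) : ℤ)) ≤ τ K := fun k => by
    have := tan_pi_mul_div_le (K := K) (D := ((k : ℕ) : ℤ) - ((i : ℕ) : ℤ))
      (by exact_mod_cast abs_sub_lt i k)
    simpa only [hτ, Int.cast_natCast] using this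
  have hge : ∀ k, - τ K ≤ τ (((k : Fin (2 * K + 1)) : ℕ) - ((i : ℕ) : ℤ)) := fun k => by
    have := tan_pi_mul_div_le (K := K) (D := -(((k : ℕ) : ℤ) - ((i : ℕ) : ℤ)))
      (by rw [abs_neg]; exact_mod_cast abs_sub_lt i k)
    have h2 : τ (-(((k : ℕ) : ℤ) - ((i : ℕ) : ℤ))) ≤ τ K := by
      simpa only [hτ, Int.cast_natCast] using this
    rw [hneg] at h2
    linarith
  have hcases : τ (((j : ℕ) : ℤ) - ((i : ℕ) : ℤ)) = τ K ∨
      τ (((j : ℕ) : ℤ) - ((i : ℕ) : ℤ)) = - τ K := by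
    rcases h with h | h | h | h <;> rw [h]
    · exact Or.inl rfl
    · exact Or.inr (hneg _)
    · exact Or.inr hper
    · left
      rw [hneg, hper, neg_neg]
  have hx : ∀ k, k ≠ i → polygonAbscissa K i k =
      - Real.sin (polygonAngle K i) - c * τ (((k : ℕ) : ℤ) - ((i : ℕ) : ℤ)) :=
    fun k hk => polygonAbscissa_eq hk.symm
  rcases lt_or_gt_of_ne (cos_polygonAngle_ne_zero i) with hneg' | hpos' <;>
    rcases hcases with hj | hj
  · refine Or.inr ?_
    rintro ⟨k, hki, -, hk⟩
    rw [hx k hki, hx j hij.symm, hj] at hk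
    nlinarith [hle k]
  · refine Or.inl ?_
    rintro ⟨k, hki, -, hk⟩
    rw [hx k hki, hx j hij.symm, hj] at hk
    nlinarith [hge k]
  · refine Or.inl ?_
    rintro ⟨k, hki, -, hk⟩
    rw [hx k hki, hx j hij.symm, hj] at hk
    nlinarith [hle k]
  · refine Or.inr ?_
    rintro ⟨k, hki, -, hk⟩
    rw [hx k hki, hx j hij.symm, hj] at hk
    nlinarith [hge k]

theorem existsLines_self {n : ℕ} (hn : 3 ≤ n) (hodd : Odd n) : ExistsLines n n := by
  obtain ⟨K, rfl⟩ := hodd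
  refine ⟨_, _, ?_, crossingsDistinct_polygon (K := K), ?_⟩
  · intro i j h
    by_contra hij
    refine tan_ne_tan_of_sin_sub_ne_zero (cos_polygonAngle_ne_zero i) (cos_polygonAngle_ne_zero j)
      ?_ h
    have e : polygonAngle K i - polygonAngle K j =
        2 * (Real.pi * (((i : ℕ) : ℤ) - ((j : ℕ) : ℤ) : ℤ) / (2 * K + 1)) := by
      rw [polygonAngle, polygonAngle]
      push_cast
      ring
    rw [e, Real.sin_two_mul]
    exact mul_ne_zero (mul_ne_zero two_ne_zero (sin_pi_mul_div_ne_zero (fin_sub_ne_zero (Ne.symm hij))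
      (by exact_mod_cast abs_sub_lt j i))) (cos_pi_mul_div_ne_zero K _)
  · change degreeCount (polygonAbscissa K) 2 = _
    refine le_antisymm ?_ ?_
    · have := degreeCount_three_add (crossingsDistinct_polygon (K := K)) hn
      omega
    · -- the sides `i` and `i + K`, and `i` and `i + K + 1`, meet in a vertex of degree two
      let f : Fin (2 * K + 1) → Fin (2 * K + 1) × Fin (2 * K + 1) := fun k =>
        if h : (k : ℕ) ≤ K then (k, ⟨k + K, by omega⟩) else (⟨k - (K + 1), by omega⟩, k)
      have hf : Function.Injective f := by
        intro k k' e
        simp only [f] at e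
        split_ifs at e <;> simp only [Prod.mk.injEq, Fin.ext_iff] at e ⊢ <;> omega
      calc 2 * K + 1 = (Finset.univ.image f).card := by
            rw [Finset.card_image_of_injective _ hf, Finset.card_univ, Fintype.card_fin]
        _ ≤ degreeCount (polygonAbscissa K) 2 := by
          refine Finset.card_le_card fun p hp => ?_
          obtain ⟨k, -, rfl⟩ := Finset.mem_image.1 hp
          have hlt : (f k).1 < (f k).2 := by
            simp only [f]
            split_ifs <;> simp only [Fin.lt_def] <;> omega
          have hsub : (((f k).2 : ℕ) : ℤ) - ((f k).1 : ℕ) = K ∨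
              (((f k).2 : ℕ) : ℤ) - ((f k).1 : ℕ) = K + 1 := by
            simp only [f]
            split_ifs <;> simp only <;> omega
          rw [Finset.mem_filter, crossingPairs, Finset.mem_filter]
          refine ⟨⟨Finset.mem_univ _, hlt⟩,
            (crossingDegree_eq_two_iff crossingsDistinct_polygon hn hlt.ne).2
              ⟨isExtreme_polygon hlt.ne (by omega), isExtreme_polygon hlt.ne' (by omega)⟩⟩

end

/-! ### The characterization -/

theorem DegreeCondition.isArrangementDegreeSequence {π : List ℕ} (h : DegreeCondition π) :
    IsArrangementDegreeSequence IsLine π := by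
  obtain ⟨n, d₂, d₃, d₄, hn, ⟨rfl, h3, hle, hd3, hd4⟩, hodd⟩ := h
  have hex : ExistsLines n d₂ := by
    rcases hle.lt_or_eq with hlt | rfl
    · exact existsLines_of_lt h3 hlt
    · exact existsLines_self hn (hodd rfl)
  obtain ⟨m, c, hm, hd, rfl⟩ := hex
  exact ⟨_, isSimpleArrangement_graphLine hn hm hd,
    (isCurveFamily_graphLine hm hd).isDegreeSequence hn hd3 hd4⟩


end PlaneArrangement

theorem theorem1 (π : List ℕ) (hsorted : π.Pairwise (· ≥ ·)) (hpos : ∀ d ∈ π, 0 < d) :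
    (PlaneArrangement.IsArrangementDegreeSequence PlaneArrangement.IsPseudoline π ↔
      PlaneArrangement.DegreeCondition π) ∧
    (PlaneArrangement.IsArrangementDegreeSequence PlaneArrangement.IsLine π ↔
      PlaneArrangement.DegreeCondition π) := by
  have hmono : PlaneArrangement.IsArrangementDegreeSequence PlaneArrangement.IsLine π →
      PlaneArrangement.IsArrangementDegreeSequence PlaneArrangement.IsPseudoline π :=
    fun ⟨L, hL, hπ⟩ => ⟨L, hL.mono fun _ hl => hl.isPseudoline, hπ⟩
  have hnec : PlaneArrangement.IsArrangementDegreeSequence PlaneArrangement.IsPseudoline π →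
      PlaneArrangement.DegreeCondition π :=
    fun ⟨_, hL, hπ⟩ => hL.degreeCondition hπ
  exact ⟨⟨hnec, fun h => hmono h.isArrangementDegreeSequence⟩,
    fun h => hnec (hmono h), fun h => h.isArrangementDegreeSequence⟩
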